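/- **Setting.** Let $\mathcal P$ be a Polish space with Borel $\sigma$-field $\mathcal B(\mathcal P)$, $\pi$ a probability measure on $\mathcal P$, $(\mathrm{filt}_z)_{z\in\mathbb R}$ a non-decreasing family of sub-$\sigma$-fields of $\mathcal B(\mathcal P)$, and $(z,x)\mapsto \pi_z(x,\cdot)$ a Markov kernel from $\mathbb R\times\mathcal P$ to $\mathcal P$. Write $\pi_z(\varphi)(x)=\int\varphi\,d\pi_z(x,\cdot)$, $\pi(\varphi)=\int\varphi\,d\pi$, and set $\pi_{-\infty}(x,\cdot)=\pi$, $\pi_{+\infty}(x,\cdot)=\delta_x$. Assume: * (right-continuity) for all $x\in\mathcal P$ and all continuous bounded $\varphi:\mathcal P\to\mathbb R$, the map $z\mapsto\pi_z(\varphi)(x)$ is right-continuous on $\mathbb R$ and tends to $\pi(\varphi)$ as $z\to-\infty$; * (consistency) if $X$ has law $\pi_z(x,\cdot)$ for some $z\in\mathbb R\cup\{-\infty\}$ and $x\in\mathcal P$, then for every real $z'\ge z$ and every bounded measurable $\varphi:\mathcal P\to\mathbb R$, $\mathbb E(\varphi(X)\mid X^{-1}(\mathrm{filt}_{z'}))=\pi_{z'}(\varphi)(X)$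 a.s. For a $\sigma$-field $\mathcal E$ on a set $E$ and a random finite set $I\subset\mathbb N^*$, let $\mathcal E^{\mathrm{rep}}$ be the disjoint union over the finite sets $J\subset\mathbb N^*$ of the product $\sigma$-fields $\mathcal E^{J}$, and for a random system $\mathcal Y=(Y^{(n)})_{n\in I}$ of elements of $E$ let $\mathcal Y^{-1}(\mathcal E^{\mathrm{rep}})$ be its pull-back to the probability space. For $\mathcal X=(X^{(n)})_{n\in I}$ in $\mathcal P$ let $\mathrm{filt}^{\mathcal X}_z=\mathcal X^{-1}(\mathrm{filt}_z^{\mathrm{rep}})$. If $Z$ is a stopping level of a filtration $(\mathcal F_z)_{z\in\mathbb R}$, i.e. a $(-\infty,+\infty]$-valued variable with $\{Z\le z\}\in\mathcal F_z$ for all real $z$, then $\mathcal F_Z$ is the $\sigma$-field of the events $A\in\bigvee_z\mathcal F_z$ with $A\cap\{Z\le z\}\in\mathcal F_z$ for all real $z$. **The algorithm** (run for all $q\ge0$ on a probability space). *Initialization.* $I^{(0)}=\{1,\dots,N\}$ with $N\ge1$ deterministic; $(X^{(n,0)})_{n\in I^{(0)}}$ are i.i.d. of law $\pi$; $G^{(n,0)}=1/N$;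 $\mathcal F^{(0)}_z=\mathrm{filt}_z^{\mathcal X^{(0)}}$, where $\mathcal X^{(q)}=(X^{(n,q)})_{n\in I^{(q)}}$. *Levels and stopping.* For each $q\ge 0$, $Z^{(q)}$ is a stopping level of $(\mathcal F^{(q)}_z)_{z\in\mathbb R}$ and $Z^{(q+1)}\ge Z^{(q)}$ a.s. Put $\mathcal F^{(q)}=\mathcal F^{(q)}_{Z^{(q)}}$. The variable $S^{(q)}\in\{0,1\}$ is $\mathcal F^{(q)}$-measurable, and $Q_{\rm iter}=\inf\{q\ge0: S^{(q)}=0\}$, with $\inf\emptyset=+\infty$. *Branching.* There are $\mathbb N$-valued branching numbers $(B^{(n,q+1)})_{n\in I^{(q)}}$. Put $I^{(q+1)}_{\rm surv}=\{n\in I^{(q)}:B^{(n,q+1)}\ge1\}$, $K^{(q+1)}=\sum_{n\in I^{(q)}}\max\{B^{(n,q+1)}-1,0\}$, $I^{(q+1)}_{\rm new}=\{\max I^{(q)}+1,\dots,\max I^{(q)}+K^{(q+1)}\}$ (empty if $K^{(q+1)}=0$) and $I^{(q+1)}=I^{(q+1)}_{\rm surv}\sqcup I^{(q+1)}_{\rm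 new}$. The children-parent map $P^{(q+1)}:I^{(q+1)}\to I^{(q+1)}_{\rm surv}$ is the identity on $I^{(q+1)}_{\rm surv}$, and each $n\in I^{(q+1)}_{\rm surv}$ is the image of exactly $B^{(n,q+1)}-1$ elements of $I^{(q+1)}_{\rm new}$. The branching numbers and $P^{(q+1)}$ are sampled conditionally on $\mathcal F^{(q)}$: almost surely they equal a function, measurable with respect to $\mathcal F^{(q)}\otimes\mathcal B(\mathbb R)$, of $(\omega,U(\omega))$, with a real random variable $U$ independent of all the label sets, replicas and children-parent maps introduced before. For all $n\in I^{(q)}$, $0<\mathbb E(B^{(n,q+1)}\mid\mathcal F^{(q)})<\infty$ a.s., where the conditional expectation is taken in $[0,\infty]$. The weights are $$G^{(n',q+1)}=\frac{G^{(n,q)}}{\mathbb E(B^{(n,q+1)}\mid\mathcal F^{(q)})}\quad\text{a.s.},\qquad n=P^{(q+1)}(n'),\ n'\in I^{(q+1)}.$$ *Resampling.* $X^{(n,q+1)}=X^{(n,q)}$ for $n\in I^{(q+1)}_{\rm surv}$. For $n'\in I^{(q+1)}_{\rm new}$, $X^{(n',q+1)}$ is sampled from $\pi_{Z^{(q)}}(X^{(P^{(q+1)}(n'),q)},\cdot)$: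 almost surely it equals $f_{n'}(Z^{(q)},X^{(P^{(q+1)}(n'),q)},U_{n'})$ with $f_{n'}$ measurable and with real random variables $U_{n'}$ that are independent of each other and, jointly, of all the label sets, replicas and children-parent maps introduced before, such that the law of $f_{n'}(z,x,U_{n'})$ is $\pi_z(x,\cdot)$ for almost every value $(z,x)$ of $(Z^{(q)},X^{(P^{(q+1)}(n'),q)})$. Finally $\mathcal F^{(q+1)}_z=\mathcal F^{(q)}\vee\sigma(P^{(q+1)})\vee\mathrm{filt}_z^{\mathcal X^{(q+1)}}$, where $\sigma(P^{(q+1)})$ is the $\sigma$-field generated by the random map $P^{(q+1)}$, its random domain $I^{(q+1)}$ included. **Theorem.** Assume that $Q_{\rm iter}<\infty$ a.s., and that either $Q_{\rm iter}$ is bounded by a deterministic constant or $\sum_{n\in I^{(q)}}G^{(n,q)}=1$ a.s. for all $q\ge0$. Then for every bounded measurable $\varphi:\mathcal P\to\mathbb R$ the variable $\sum_{n\in I^{(Q_{\rm iter})}}G^{(n,Q_{\rm iter})}\varphi(X^{(n,Q_{\rm iter})})$ is integrable and $$\mathbb E\Big(\sum_{n\in I^{(Q_{\rm iter})}}G^{(n,Q_{\rm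 iter})}\varphi(X^{(n,Q_{\rm iter})})\Big)=\pi(\varphi).$$ -/

import Mathlib

open MeasureTheory ProbabilityTheory Filter Topology

/-- The random system of replicas `(Y n)_{n ∈ I}` with random finite label set `I`, seen as a random
element of the space of finite systems, the disjoint union over finite label sets `J` of `E ^ J`. -/
def repSystem {Ω E : Type*} (I : Ω → Finset ℕ) (Y : ℕ → Ω → E) (ω : Ω) :
    Σ J : Finset ℕ, (J → E) :=
  ⟨I ω, fun n => Y n ω⟩

/-- The σ-field `⨆_J 𝓔 ^ J` on the space of finite systems, for a σ-field `𝓔` on `E`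
(disjoint union over `J` of the product σ-fields). -/
abbrev repSpace {E : Type*} (𝓔 : MeasurableSpace E) : MeasurableSpace (Σ J : Finset ℕ, (J → E)) :=
  @Sigma.instMeasurableSpace (Finset ℕ) (fun J => J → E)
    (fun _ => @MeasurableSpace.pi _ (fun _ => E) (fun _ => 𝓔))

/-- Pull-back to `Ω` of `repSpace 𝓔` by the random system `(Y n)_{n ∈ I}`.
It contains the σ-field generated by the random label set `I`, and it does not depend on the
(meaningless) values `Y n ω` with `n ∉ I ω`. -/
abbrev repSigma {Ω E : Type*} (𝓔 : MeasurableSpace E) (I : Ω → Finset ℕ) (Y : ℕ → Ω → E) :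
    MeasurableSpace Ω :=
  MeasurableSpace.comap (repSystem I Y) (repSpace 𝓔)

/-- The resampling kernel `π_z(x, ·)` extended to `z = +∞` by `π_{+∞}(x, ·) = δ_x`. -/
noncomputable def levelKernel {E : Type*} [MeasurableSpace E] (κ : Kernel (ℝ × E) E) :
    WithTop ℝ → E → Measure E
  | ⊤, x => Measure.dirac x
  | (z : ℝ), x => κ (z, x)

/-- For all `x` and all continuous bounded `φ`, the map `z ↦ π_z(φ)(x)` is right-continuous on `ℝ`
and tends to `π(φ)` as `z → -∞`. -/
def RightContinuousKernel {E : Type*} [TopologicalSpace E] [MeasurableSpace E]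
    (π : Measure E) (κ : Kernel (ℝ × E) E) : Prop :=
  ∀ (x : E) (φ : BoundedContinuousFunction E ℝ),
    (∀ z : ℝ, ContinuousWithinAt (fun z' : ℝ => ∫ y, φ y ∂(κ (z', x))) (Set.Ici z) z) ∧
    Tendsto (fun z : ℝ => ∫ y, φ y ∂(κ (z, x))) atBot (𝓝 (∫ y, φ y ∂π))

/-- Under the law `ν`, for every level `z' ∈ s`, the kernel `π_{z'}` is a version of the conditional
law given `filt z'`: `E(φ(X) | filt z') = π_{z'}(φ)(X)` a.s. if `X` has law `ν` (the random variable
`X` is taken to be the canonical one). -/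
def ResamplesUnder {E : Type*} [mE : MeasurableSpace E] (filt : Filtration ℝ mE)
    (κ : Kernel (ℝ × E) E) (ν : Measure E) (s : Set ℝ) : Prop :=
  ∀ z' ∈ s, ∀ φ : E → ℝ, Measurable φ → (∃ C : ℝ, ∀ x, |φ x| ≤ C) →
    ν[φ | filt z'] =ᵐ[ν] fun x => ∫ y, φ y ∂(κ (z', x))

/-- Consistency of the resampling kernels with the level filtration: if `X` has law `π_z(x, ·)`,
with `z ∈ ℝ` or `z = -∞` (where `π_{-∞}(x, ·) = π`), then for all real `z' ≥ z` one has
`E(φ(X) | filt z') = π_{z'}(φ)(X)` a.s. -/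
structure ConsistentKernel {E : Type*} [mE : MeasurableSpace E] (filt : Filtration ℝ mE)
    (π : Measure E) (κ : Kernel (ℝ × E) E) : Prop where
  of_level : ∀ (z : ℝ) (x : E), ResamplesUnder filt κ (κ (z, x)) (Set.Ici z)
  of_bot : ResamplesUnder filt κ π Set.univ

/-- All the random variables of a splitting algorithm (run without stopping).
Only the values at labels that are present are meaningful: `X q n ω`, `G q n ω`, `B q n ω` for
`n ∈ I q ω`, and `P q n ω` for `n ∈ I (q + 1) ω`. -/
structure SplittingData (Ω E : Type*) [mΩ : MeasurableSpace Ω] where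
  /-- number of initial replicas -/
  N : ℕ
  /-- `I q` is the set of labels at iteration `q` -/
  I : ℕ → Ω → Finset ℕ
  /-- `X q n` is the replica with label `n` at iteration `q` -/
  X : ℕ → ℕ → Ω → E
  /-- `G q n` is the weight of the replica with label `n` at iteration `q` -/
  G : ℕ → ℕ → Ω → ℝ
  /-- `Z q` is the level at iteration `q` -/
  Z : ℕ → Ω → WithTop ℝ
  /-- `S q = 0` iff the stopping criterion is satisfied at iteration `q` -/
  S : ℕ → Ω → Fin 2
  /-- `B q n` is the branching number of the replica with label `n ∈ I q`, in the branching step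
  leading from iteration `q` to iteration `q + 1` -/
  B : ℕ → ℕ → Ω → ℕ
  /-- `P q` is the children-parent map, from `I (q + 1)` to the surviving labels of `I q` -/
  P : ℕ → ℕ → Ω → ℕ
  /-- `F q` is the filtration, indexed by levels, at iteration `q` -/
  F : ℕ → Filtration ℝ mΩ

namespace SplittingData

variable {Ω E : Type*} [mΩ : MeasurableSpace Ω] [mE : MeasurableSpace E]

/-- The labels in `I q` of the replicas that are not killed in the branching step. -/
def survivors (D : SplittingData Ω E) (q : ℕ) (ω : Ω) : Finset ℕ :=
  (D.I q ω).filter fun n => D.B q n ω ≠ 0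

/-- The number of new replicas created in the branching step. -/
def numNew (D : SplittingData Ω E) (q : ℕ) (ω : Ω) : ℕ :=
  ∑ n ∈ D.I q ω, (D.B q n ω - 1)

/-- The new labels `max I + 1, …, max I + K`, where `I = I q` and `K` is the number of new
replicas. -/
def newLabels (D : SplittingData Ω E) (q : ℕ) (ω : Ω) : Finset ℕ :=
  Finset.Icc ((D.I q ω).sup id + 1) ((D.I q ω).sup id + D.numNew q ω)

/-- The σ-field generated by the children-parent map `P q : I (q + 1) → I q`. -/
abbrev parentSigma (D : SplittingData Ω E) (q : ℕ) : MeasurableSpace Ω :=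
  repSigma ⊤ (D.I (q + 1)) (D.P q)

/-- The σ-field generated by all the random variables introduced up to the end of the resampling
step leading to iteration `q` (label sets, replicas and children-parent maps; branching numbers,
levels and stopping criteria are functions of these). -/
@[reducible] def history (D : SplittingData Ω E) : ℕ → MeasurableSpace Ω
  | 0 => repSigma mE (D.I 0) (D.X 0)
  | q + 1 => D.history q ⊔ D.parentSigma q ⊔ repSigma mE (D.I (q + 1)) (D.X (q + 1))

/-- The number of iterations, the first `q` with `S q = 0` (`⊤` if there is none). -/
noncomputable def Qiter (D : SplittingData Ω E) (ω : Ω) : ℕ∞ :=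
  sInf ((fun q : ℕ => (q : ℕ∞)) '' {q | D.S q ω = 0})

/-- The weighted empirical estimator at iteration `q`. -/
noncomputable def estimator (D : SplittingData Ω E) (φ : E → ℝ) (q : ℕ) (ω : Ω) : ℝ :=
  ∑ n ∈ D.I q ω, D.G q n ω * φ (D.X q n ω)

/-- Almost sure conservation of the total weight. -/
def MassConserved (D : SplittingData Ω E) (μ : Measure Ω) : Prop :=
  ∀ q, ∀ᵐ ω ∂μ, ∑ n ∈ D.I q ω, D.G q n ω = 1

end SplittingData

/-- The algorithm belongs to the Generalized Adaptive Multilevel Splitting framework, with target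
law `π`, level filtration `filt` and resampling kernels `κ`. -/
structure IsGAMS {Ω E : Type*} [mΩ : MeasurableSpace Ω] [mE : MeasurableSpace E]
    (μ : Measure Ω) (π : Measure E) (filt : Filtration ℝ mE) (κ : Kernel (ℝ × E) E)
    (D : SplittingData Ω E) : Prop where
  measurable_X : ∀ q n, Measurable (D.X q n)
  measurable_B : ∀ q n, Measurable (D.B q n)
  measurable_P : ∀ q n, Measurable (D.P q n)
  -- Initialization: `N > 0` i.i.d. replicas of law `π`, with uniform weights.
  N_pos : 0 < D.N
  I_zero : ∀ ω, D.I 0 ω = Finset.Icc 1 D.N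
  X_zero_indep : iIndepFun (fun n : Finset.Icc 1 D.N => D.X 0 n) μ
  X_zero_law : ∀ n ∈ Finset.Icc 1 D.N, μ.map (D.X 0 n) = π
  G_zero : ∀ ω, ∀ n ∈ D.I 0 ω, D.G 0 n ω = 1 / (D.N : ℝ)
  F_zero : ∀ z : ℝ, D.F 0 z = repSigma (filt z) (D.I 0) (D.X 0)
  -- Levels: non-decreasing stopping levels. The σ-field `𝓕 q` after iteration `q` is
  -- `(Z_stopping q).measurableSpace`, the σ-field of `F q` stopped at `Z q`.
  Z_stopping : ∀ q, IsStoppingTime (D.F q) (D.Z q)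
  Z_mono : ∀ q, ∀ᵐ ω ∂μ, D.Z q ω ≤ D.Z (q + 1) ω
  F_succ : ∀ (q : ℕ) (z : ℝ), D.F (q + 1) z =
    (Z_stopping q).measurableSpace ⊔ D.parentSigma q ⊔ repSigma (filt z) (D.I (q + 1)) (D.X (q + 1))
  -- Stopping criterion.
  S_measurable : ∀ q, Measurable[(Z_stopping q).measurableSpace] (D.S q)
  -- Branching step: labels and parents.
  I_succ : ∀ q ω, D.I (q + 1) ω = D.survivors q ω ∪ D.newLabels q ω
  P_new : ∀ q ω, ∀ n' ∈ D.newLabels q ω, D.P q n' ω ∈ D.survivors q ω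
  P_card : ∀ q ω, ∀ n ∈ D.survivors q ω,
    ((D.newLabels q ω).filter fun n' => D.P q n' ω = n).card = D.B q n ω - 1
  P_old : ∀ q ω, ∀ n ∈ D.survivors q ω, D.P q n ω = n
  -- Branching numbers and parents are sampled conditionally on `𝓕 q`: they are measurable
  -- functions of `𝓕 q` and of a random variable `U` independent of all variables introduced before.
  branching_sampled : ∀ q, ∃ (U : Ω → ℝ) (b p : ℕ → Ω × ℝ → ℕ),
    Measurable U ∧ Indep (MeasurableSpace.comap U inferInstance) (D.history q) μ ∧
    (∀ n, Measurable[(Z_stopping q).measurableSpace.prod inferInstance] (b n)) ∧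
    (∀ n, Measurable[(Z_stopping q).measurableSpace.prod inferInstance] (p n)) ∧
    (∀ᵐ ω ∂μ, ∀ n ∈ D.I q ω, D.B q n ω = b n (ω, U ω)) ∧
    (∀ᵐ ω ∂μ, ∀ n' ∈ D.I (q + 1) ω, D.P q n' ω = p n' (ω, U ω))
  -- The conditional mean (in `[0, ∞]`) of the branching numbers is positive and finite.
  branching_mean : ∀ q, ∀ᵐ ω ∂μ, ∀ n ∈ D.I q ω,
    0 < condLExp (Z_stopping q).measurableSpace μ (fun ω' => (D.B q n ω' : ENNReal)) ω ∧
    condLExp (Z_stopping q).measurableSpace μ (fun ω' => (D.B q n ω' : ENNReal)) ω < ⊤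
  G_succ : ∀ q, ∀ᵐ ω ∂μ, ∀ n' ∈ D.I (q + 1) ω, ∀ n ∈ D.survivors q ω, D.P q n' ω = n →
    D.G (q + 1) n' ω = D.G q n ω /
      (condLExp (Z_stopping q).measurableSpace μ (fun ω' => (D.B q n ω' : ENNReal)) ω).toReal
  -- Resampling step: surviving replicas are kept, new ones are independently sampled from their
  -- parent with the resampling kernel at the current level, using fresh randomness `U n'`.
  X_old : ∀ q ω, ∀ n ∈ D.survivors q ω, D.X (q + 1) n ω = D.X q n ω
  X_new : ∀ q, ∃ (U : ℕ → Ω → ℝ) (f : ℕ → (WithTop ℝ × E) × ℝ → E),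
    (∀ n', Measurable (U n')) ∧ iIndepFun U μ ∧
    Indep (⨆ n', MeasurableSpace.comap (U n') inferInstance)
      (D.history q ⊔ D.parentSigma q) μ ∧
    (∀ n', Measurable (f n')) ∧
    (∀ᵐ ω ∂μ, ∀ n' ∈ D.newLabels q ω,
      μ.map (fun ω' => f n' ((D.Z q ω, D.X q (D.P q n' ω) ω), U n' ω')) =
        levelKernel κ (D.Z q ω) (D.X q (D.P q n' ω) ω)) ∧
    (∀ᵐ ω ∂μ, ∀ n' ∈ D.newLabels q ω,
      D.X (q + 1) n' ω = f n' ((D.Z q ω, D.X q (D.P q n' ω) ω), U n' ω))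

/-! Take `φ ≥ 0` bounded and let `M q` be the weighted sum of the `φ (X q n)`. The core is a
martingale-type identity: `M (q + 1)` and `M q` have the same integral over every event of `𝓕 q`,
although `M q` need not be `𝓕 q`-measurable (`setLIntegral_lestimator_succ`). Since the event that
the algorithm still runs after iteration `q` lies in `𝓕 q`, the mean of `M` at `min Qiter q` does
not depend on `q`, and it equals `π(φ)` at `q = 0` (`lintegral_stopped_lestimator`). Letting `q`
grow is trivial if `Qiter` is bounded, and dominated convergence applies if the total weight is one.
A signed `φ` bounded by `C` is the difference of `φ + C` and `C`.

The identity holds because, given `𝓕 q`, the replicas are independent with laws `π_Z(X n, ·)`, where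
`Z = Z q` (`condIndep_stopped`). A child, whether surviving or new, therefore has the same
conditional law as its parent; a parent has `B` children, and the weights are divided by the
conditional mean of `B`.

This conditional independence is proved along an induction on `q` (`condIndep`), whose statement
concerns the σ-field `priorSigma q` available before the replicas of iteration `q` are revealed. Two
steps carry it. The first goes from `priorSigma q` to the σ-field stopped at `Z q`: consistency of
the kernels settles fixed levels, the random level is approximated from above by discrete ones, and
right-continuity gives the limit for continuous test functions, hence for measurable ones
(`CondIndepWithLaws.setLIntegral_prod_stopped`). The second crosses branching and resampling, by
integrating out fresh randomness that is independent of the whole past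
(`setLIntegral_prod_branching`).

All of this is written with integrals in `[0, ∞]` over events, since `π_Z(φ)(X n)` need not be
exactly measurable for the stopped σ-field. -/

open scoped ENNReal NNReal BoundedContinuousFunction

/-! ### Bounded test functions and tools on integrals in `[0, ∞]` -/

/-- A measurable function with values in `[0, ∞]` that is bounded by a finite constant. -/
def BoundedMeasurable {E : Type*} [MeasurableSpace E] (g : E → ℝ≥0∞) : Prop :=
  Measurable g ∧ ∃ c : ℝ≥0, ∀ x, g x ≤ c

namespace BoundedMeasurable

variable {E : Type*} [MeasurableSpace E]

lemma const (c : ℝ≥0) : BoundedMeasurable (fun _ : E => (c : ℝ≥0∞)) :=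
  ⟨measurable_const, c, fun _ => le_rfl⟩

lemma one : BoundedMeasurable (fun _ : E => (1 : ℝ≥0∞)) := by
  simpa using const (E := E) 1

lemma mul {f g : E → ℝ≥0∞} (hf : BoundedMeasurable f) (hg : BoundedMeasurable g) :
    BoundedMeasurable (fun x => f x * g x) := by
  obtain ⟨hf, c, hc⟩ := hf
  obtain ⟨hg, d, hd⟩ := hg
  exact ⟨hf.mul hg, c * d, fun x => by push_cast; exact mul_le_mul' (hc x) (hd x)⟩

lemma prod {ι : Type*} (s : Finset ι) {g : ι → E → ℝ≥0∞}
    (hg : ∀ i, BoundedMeasurable (g i)) : BoundedMeasurable (fun x => ∏ i ∈ s, g i x) := by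
  choose c hc using fun i => (hg i).2
  refine ⟨Finset.measurable_fun_prod _ fun i _ => (hg i).1, ∏ i ∈ s, c i, fun x => ?_⟩
  push_cast
  exact Finset.prod_le_prod' fun i _ => hc i x

lemma indicator {g : E → ℝ≥0∞} (hg : BoundedMeasurable g) {s : Set E} (hs : MeasurableSet s) :
    BoundedMeasurable (s.indicator g) := by
  obtain ⟨hg, c, hc⟩ := hg
  exact ⟨hg.indicator hs, c, fun x => (Set.indicator_le_self s g x).trans (hc x)⟩

lemma kernel {α : Type*} [MeasurableSpace α] {g : E → ℝ≥0∞} (hg : BoundedMeasurable g)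
    (κ : Kernel α E) [IsMarkovKernel κ] : BoundedMeasurable (fun a => ∫⁻ y, g y ∂(κ a)) := by
  obtain ⟨hg, c, hc⟩ := hg
  exact ⟨hg.lintegral_kernel, c, fun a => (lintegral_mono hc).trans (by simp)⟩

lemma comp {α : Type*} [MeasurableSpace α] {g : E → ℝ≥0∞} (hg : BoundedMeasurable g)
    {f : α → E} (hf : Measurable f) : BoundedMeasurable (fun a => g (f a)) :=
  ⟨hg.1.comp hf, hg.2.imp fun _ h _ => h _⟩

lemma continuous [TopologicalSpace E] [OpensMeasurableSpace E] (f : E →ᵇ ℝ≥0) :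
    BoundedMeasurable (fun x => (f x : ℝ≥0∞)) := by
  refine ⟨f.continuous.measurable.coe_nnreal_ennreal, nndist f 0, fun x => ?_⟩
  exact ENNReal.coe_le_coe.2 (BoundedContinuousFunction.NNReal.upper_bound f x)

lemma lintegral_ne_top {g : E → ℝ≥0∞} (hg : BoundedMeasurable g) (μ : Measure E)
    [IsFiniteMeasure μ] : ∫⁻ x, g x ∂μ ≠ ∞ := by
  obtain ⟨-, c, hc⟩ := hg
  refine ne_top_of_le_ne_top ?_ (lintegral_mono hc)
  simp [ENNReal.mul_eq_top]

end BoundedMeasurable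

/-- Integrating out an independent variable. -/
lemma lintegral_comp_of_indepFun {Ω α β : Type*} [MeasurableSpace Ω] [MeasurableSpace α]
    [MeasurableSpace β] {μ : Measure Ω} [IsProbabilityMeasure μ] {T : Ω → α} (hT : Measurable T)
    {U : Ω → β} (hU : Measurable U) (hind : IndepFun T U μ) {h : α × β → ℝ≥0∞}
    (hh : Measurable h) :
    ∫⁻ ω, h (T ω, U ω) ∂μ = ∫⁻ ω, ∫⁻ u, h (T ω, u) ∂(μ.map U) ∂μ := by
  have := Measure.isProbabilityMeasure_map (μ := μ) hT.aemeasurable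
  have := Measure.isProbabilityMeasure_map (μ := μ) hU.aemeasurable
  rw [← lintegral_map (f := h) hh (hT.prodMk hU),
    (indepFun_iff_map_prod_eq_prod_map_map hT.aemeasurable hU.aemeasurable).1 hind,
    lintegral_prod _ hh.aemeasurable, lintegral_map hh.lintegral_prod_right' hT]

/-- Integrating out a variable independent of a σ-field. -/
lemma lintegral_comp_of_indep {Ω β : Type*} {m mΩ : MeasurableSpace Ω} [mβ : MeasurableSpace β]
    {μ : Measure Ω} [IsProbabilityMeasure μ] (hm : m ≤ mΩ) {U : Ω → β} (hU : Measurable U)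
    (hind : Indep (MeasurableSpace.comap U mβ) m μ) {h : Ω × β → ℝ≥0∞}
    (hh : Measurable[m.prod mβ] h) :
    ∫⁻ ω, h (ω, U ω) ∂μ = ∫⁻ ω, ∫⁻ u, h (ω, u) ∂(μ.map U) ∂μ := by
  -- The identity, viewed as a random element of `(Ω, m)`, generates `m`; this reduces the claim to
  -- independent variables.
  have hI : @IndepFun _ _ _ mΩ m mβ id U μ := by
    refine (@IndepFun_iff_Indep _ _ _ mΩ m mβ id U μ).2 ?_
    rw [MeasurableSpace.comap_id]
    exact hind.symm
  exact @lintegral_comp_of_indepFun Ω Ω β mΩ m mβ μ _ id (measurable_id'' hm) U hU hI h hh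

/-- Two functions with the same integrals on the sets of a σ-field have the same integrals against
weights measurable with respect to this σ-field. -/
lemma lintegral_mul_eq_of_setLIntegral_eq {Ω : Type*} {m mΩ : MeasurableSpace Ω} {μ : Measure Ω}
    (hm : m ≤ mΩ) {F G w : Ω → ℝ≥0∞} (hF : Measurable F) (hG : Measurable G)
    (hw : Measurable[m] w)
    (h : ∀ A, MeasurableSet[m] A → ∫⁻ ω in A, F ω ∂μ = ∫⁻ ω in A, G ω ∂μ) :
    ∫⁻ ω, w ω * F ω ∂μ = ∫⁻ ω, w ω * G ω ∂μ := by
  have key : (μ.withDensity F).trim hm = (μ.withDensity G).trim hm := by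
    refine @Measure.ext _ m _ _ fun A hA => ?_
    rw [trim_measurableSet_eq hm hA, trim_measurableSet_eq hm hA, withDensity_apply _ (hm _ hA),
      withDensity_apply _ (hm _ hA), h A hA]
  have aux : ∀ {H : Ω → ℝ≥0∞}, Measurable H →
      ∫⁻ ω, w ω * H ω ∂μ = ∫⁻ ω, w ω ∂((μ.withDensity H).trim hm) := fun {H} hH => by
    rw [lintegral_trim hm hw, lintegral_withDensity_eq_lintegral_mul _ hH (hw.mono hm le_rfl)]
    simp [mul_comm]
  rw [aux hF, aux hG, key]

/-- Two finite integrals which agree on intersections of sets of a σ-field and of a π-system agree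
on the σ-field that these generate. -/
lemma setLIntegral_eq_of_sup_generateFrom {Ω : Type*} {m mΩ : MeasurableSpace Ω} {μ : Measure Ω}
    (hm : m ≤ mΩ) {𝒞 : Set (Set Ω)} (h𝒞 : IsPiSystem 𝒞)
    (h𝒞m : MeasurableSpace.generateFrom 𝒞 ≤ mΩ) (huniv : Set.univ ∈ 𝒞)
    {F G : Ω → ℝ≥0∞} (hF : ∫⁻ ω, F ω ∂μ ≠ ∞)
    (h : ∀ A, MeasurableSet[m] A → ∀ C ∈ 𝒞,
      ∫⁻ ω in A ∩ C, F ω ∂μ = ∫⁻ ω in A ∩ C, G ω ∂μ)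
    {B : Set Ω} (hB : MeasurableSet[m ⊔ MeasurableSpace.generateFrom 𝒞] B) :
    ∫⁻ ω in B, F ω ∂μ = ∫⁻ ω in B, G ω ∂μ := by
  have hle : m ⊔ MeasurableSpace.generateFrom 𝒞 ≤ mΩ := sup_le hm h𝒞m
  have hgen : m ⊔ MeasurableSpace.generateFrom 𝒞 =
      MeasurableSpace.generateFrom {s | ∃ A, MeasurableSet[m] A ∧ ∃ C ∈ 𝒞, s = A ∩ C} := by
    apply le_antisymm
    · refine sup_le (fun A hA => MeasurableSpace.measurableSet_generateFrom
        ⟨A, hA, Set.univ, huniv, by simp⟩) ?_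
      refine MeasurableSpace.generateFrom_mono fun C hC => ⟨Set.univ, .univ, C, hC, by simp⟩
    · refine MeasurableSpace.generateFrom_le ?_
      rintro _ ⟨A, hA, C, hC, rfl⟩
      exact (le_sup_left (b := MeasurableSpace.generateFrom 𝒞) A hA).inter
        (le_sup_right (a := m) C (MeasurableSpace.measurableSet_generateFrom hC))
  have hpi : IsPiSystem {s | ∃ A, MeasurableSet[m] A ∧ ∃ C ∈ 𝒞, s = A ∩ C} := by
    rintro _ ⟨A, hA, C, hC, rfl⟩ _ ⟨A', hA', C', hC', rfl⟩ hne
    rw [Set.inter_inter_inter_comm] at hne ⊢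
    exact ⟨_, hA.inter hA', _, h𝒞 _ hC _ hC' (hne.mono Set.inter_subset_right), rfl⟩
  have hfin : IsFiniteMeasure (μ.withDensity F) := isFiniteMeasure_withDensity hF
  have hfin' := isFiniteMeasure_trim (μ := μ.withDensity F) hle
  -- Uniqueness of measures on a π-system. Finiteness is needed for `F` only: `univ ∈ 𝒞` makes the
  -- total masses agree.
  have key : (μ.withDensity F).trim hle = (μ.withDensity G).trim hle := by
    refine @ext_of_generate_finite _ (m ⊔ MeasurableSpace.generateFrom 𝒞) _ _ _ hgen hpi hfin' ?_ ?_
    · rintro _ ⟨A, hA, C, hC, rfl⟩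
      have hAC := (le_sup_left (b := MeasurableSpace.generateFrom 𝒞) A hA).inter
        (le_sup_right (a := m) C (MeasurableSpace.measurableSet_generateFrom hC))
      rw [trim_measurableSet_eq hle hAC, trim_measurableSet_eq hle hAC,
        withDensity_apply _ (hle _ hAC), withDensity_apply _ (hle _ hAC), h A hA C hC]
    · rw [trim_measurableSet_eq hle .univ, trim_measurableSet_eq hle .univ,
        withDensity_apply _ .univ, withDensity_apply _ .univ]
      simpa using h _ .univ _ huniv
  have := congrArg (fun ν => ν B) key
  simpa [trim_measurableSet_eq hle hB, withDensity_apply _ (hle _ hB)] using this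

/-- Decomposition of an integral according to the values of a discrete variable. -/
lemma setLIntegral_eq_of_forall_fiber {Ω α : Type*} [MeasurableSpace Ω] {μ : Measure Ω}
    [Countable α] {Y : Ω → α} (hY : ∀ y, MeasurableSet {ω | Y ω = y}) {S : Set Ω}
    (hS : MeasurableSet S) {F G : Ω → ℝ≥0∞}
    (h : ∀ y, ∫⁻ ω in S ∩ {ω | Y ω = y}, F ω ∂μ = ∫⁻ ω in S ∩ {ω | Y ω = y}, G ω ∂μ) :
    ∫⁻ ω in S, F ω ∂μ = ∫⁻ ω in S, G ω ∂μ := by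
  have hun : S = ⋃ y, S ∩ {ω | Y ω = y} := by ext; simp
  have hdis : Pairwise (Function.onFun Disjoint fun y => S ∩ {ω | Y ω = y}) := fun y y' hne => by
    refine Set.disjoint_left.2 fun ω hω hω' => hne ?_
    rw [← hω.2, ← hω'.2]
  rw [hun, lintegral_iUnion (fun y => hS.inter (hY y)) hdis,
    lintegral_iUnion (fun y => hS.inter (hY y)) hdis]
  exact tsum_congr h

/-! ### From continuous to measurable test functions -/

lemma BoundedMeasurable.kernel_prod {Ω E ι : Type*} [MeasurableSpace Ω] [MeasurableSpace E]
    (s : Finset ι) (a : ι → Kernel Ω E) [∀ i, IsMarkovKernel (a i)] {g : ι → E → ℝ≥0∞}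
    (hg : ∀ i, BoundedMeasurable (g i)) :
    BoundedMeasurable fun ω => ∏ i ∈ s, ∫⁻ y, g i y ∂(a i ω) :=
  .prod s fun i => (hg i).kernel (a i)

/-- Two mixtures of finite products of probability kernels which agree on products of bounded
continuous functions agree on products of bounded measurable functions. -/
lemma lintegral_prod_kernel_eq_of_continuous {Ω E ι : Type*} [MeasurableSpace Ω]
    [TopologicalSpace E] [HasOuterApproxClosed E] [MeasurableSpace E] [BorelSpace E]
    {ν : Measure Ω} [IsFiniteMeasure ν] {s : Finset ι} {a b : ι → Kernel Ω E}
    [∀ i, IsMarkovKernel (a i)] [∀ i, IsMarkovKernel (b i)]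
    (H : ∀ f : ι → E →ᵇ ℝ≥0, ∫⁻ ω, ∏ i ∈ s, ∫⁻ y, f i y ∂(a i ω) ∂ν =
      ∫⁻ ω, ∏ i ∈ s, ∫⁻ y, f i y ∂(b i ω) ∂ν)
    {g : ι → E → ℝ≥0∞} (hg : ∀ i, BoundedMeasurable (g i)) :
    ∫⁻ ω, ∏ i ∈ s, ∫⁻ y, g i y ∂(a i ω) ∂ν = ∫⁻ ω, ∏ i ∈ s, ∫⁻ y, g i y ∂(b i ω) ∂ν := by
  classical
  -- Induction on the set `t` of indices whose test function is allowed to be merely measurable.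
  suffices H' : ∀ t ⊆ s, ∀ g : ι → E → ℝ≥0∞, (∀ i, BoundedMeasurable (g i)) →
      (∀ i ∈ s, i ∉ t → ∃ f : E →ᵇ ℝ≥0, g i = fun x => (f x : ℝ≥0∞)) →
      ∫⁻ ω, ∏ i ∈ s, ∫⁻ y, g i y ∂(a i ω) ∂ν = ∫⁻ ω, ∏ i ∈ s, ∫⁻ y, g i y ∂(b i ω) ∂ν from
    H' s le_rfl g hg fun i hi hi' => (hi' hi).elim
  intro t
  induction t using Finset.induction_on with
  | empty =>
    intro _ g hg hc
    have : ∀ i, ∃ f : E →ᵇ ℝ≥0, i ∈ s → g i = fun x => (f x : ℝ≥0∞) := fun i => by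
      by_cases hi : i ∈ s
      · obtain ⟨f, hf⟩ := hc i hi (by simp)
        exact ⟨f, fun _ => hf⟩
      · exact ⟨0, fun h => (hi h).elim⟩
    choose f hf using this
    have aux : ∀ a : ι → Kernel Ω E, ∫⁻ ω, ∏ i ∈ s, ∫⁻ y, g i y ∂(a i ω) ∂ν =
        ∫⁻ ω, ∏ i ∈ s, ∫⁻ y, f i y ∂(a i ω) ∂ν := fun a =>
      lintegral_congr fun ω => Finset.prod_congr rfl fun i hi => by rw [hf i hi]
    rw [aux a, aux b, H]
  | insert m t hm ih =>
    intro hts g hg hc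
    have hms : m ∈ s := hts (Finset.mem_insert_self m t)
    -- With the other factors frozen as a density, the integral is that of the `m`-th function
    -- against a finite measure on `E`, and such a measure is determined by bounded continuous
    -- functions.
    have main : ∀ (c : ι → Kernel Ω E) [∀ i, IsMarkovKernel (c i)] (h : E → ℝ≥0∞),
        Measurable h → ∫⁻ ω, ∏ i ∈ s, ∫⁻ y, Function.update g m h i y ∂(c i ω) ∂ν =
          ∫⁻ y, h y ∂((ν.withDensity fun ω => ∏ i ∈ s.erase m, ∫⁻ y, g i y ∂(c i ω)).bind
            (c m)) := by
      intro c _ h hh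
      have hW := (BoundedMeasurable.kernel_prod (s.erase m) c hg).1
      rw [Measure.lintegral_bind (c m).aemeasurable hh.aemeasurable,
        lintegral_withDensity_eq_lintegral_mul _ hW hh.lintegral_kernel]
      refine lintegral_congr fun ω => ?_
      rw [← Finset.prod_erase_mul _ _ hms]
      simp only [Pi.mul_apply, Function.update_self]
      congr 1
      refine Finset.prod_congr rfl fun i hi => ?_
      rw [Function.update_of_ne (Finset.ne_of_mem_erase hi)]
    have hfin : ∀ (c : ι → Kernel Ω E) [∀ i, IsMarkovKernel (c i)],
        IsFiniteMeasure ((ν.withDensity fun ω => ∏ i ∈ s.erase m, ∫⁻ y, g i y ∂(c i ω)).bind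
            (c m)) := fun c _ => by
      have := isFiniteMeasure_withDensity
        ((BoundedMeasurable.kernel_prod (s.erase m) c hg).lintegral_ne_top ν)
      infer_instance
    have hfa := hfin a
    have key : (ν.withDensity fun ω => ∏ i ∈ s.erase m, ∫⁻ y, g i y ∂(a i ω)).bind (a m) =
        (ν.withDensity fun ω => ∏ i ∈ s.erase m, ∫⁻ y, g i y ∂(b i ω)).bind (b m) := by
      refine ext_of_forall_lintegral_eq_of_IsFiniteMeasure fun f => ?_
      have hf := BoundedMeasurable.continuous f
      rw [← main a _ hf.1, ← main b _ hf.1]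
      refine ih ((Finset.subset_insert m t).trans hts) _ (fun i => ?_) fun i his hit => ?_
      · rcases eq_or_ne i m with rfl | hi
        · simpa using hf
        · simpa [hi] using hg i
      · rcases eq_or_ne i m with rfl | hi
        · exact ⟨f, by simp⟩
        · simpa [hi] using hc i his (by simp [hi, hit])
    have := congrArg (fun ρ => ∫⁻ y, g m y ∂ρ) key
    simpa only [← main a _ (hg m).1, ← main b _ (hg m).1, Function.update_eq_self] using this

/-! ### Resampling kernels as conditional laws -/

/-- `k` is a version of the conditional law given `m` under `ν`, in terms of integrals of functions
with values in `[0, ∞]`. -/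
structure IsConditionalKernel {E : Type*} (m : MeasurableSpace E) [MeasurableSpace E]
    (k : Kernel E E) (ν : Measure E) : Prop where
  exists_measurable : ∀ h : E → ℝ≥0∞, BoundedMeasurable h →
    ∃ w, Measurable[m] w ∧ (fun x => ∫⁻ y, h y ∂(k x)) =ᵐ[ν] w
  lintegral_mul : ∀ h : E → ℝ≥0∞, BoundedMeasurable h → ∀ w : E → ℝ≥0∞, Measurable[m] w →
    ∫⁻ x, w x * h x ∂ν = ∫⁻ x, w x * ∫⁻ y, h y ∂(k x) ∂ν

lemma ResamplesUnder.isConditionalKernel {E : Type*} [mE : MeasurableSpace E]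
    {filt : Filtration ℝ mE} {κ : Kernel (ℝ × E) E} [IsMarkovKernel κ] {ν : Measure E}
    [IsProbabilityMeasure ν] {s : Set ℝ} (h : ResamplesUnder filt κ ν s) {z : ℝ} (hz : z ∈ s) :
    IsConditionalKernel (filt z) (κ.sectR z) ν := by
  have key : ∀ g : E → ℝ≥0∞, BoundedMeasurable g →
      Integrable (fun x => (g x).toReal) ν ∧
      (fun x => ∫⁻ y, g y ∂(κ.sectR z x)) =ᵐ[ν]
        fun x => ENNReal.ofReal ((ν[fun x => (g x).toReal|filt z]) x) := by
    intro g hg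
    obtain ⟨hgm, c, hc⟩ := hg
    have hb : ∀ x, |(g x).toReal| ≤ c := fun x => by
      rw [abs_of_nonneg ENNReal.toReal_nonneg]
      exact ENNReal.toReal_le_coe_of_le_coe (hc x)
    refine ⟨Integrable.of_bound hgm.ennreal_toReal.aestronglyMeasurable c (ae_of_all _ hb), ?_⟩
    filter_upwards [h z hz _ hgm.ennreal_toReal ⟨c, hb⟩] with x hx
    rw [hx, Kernel.sectR_apply, integral_toReal hgm.aemeasurable
      (ae_of_all _ fun y => (hc y).trans_lt ENNReal.coe_lt_top), ENNReal.ofReal_toReal]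
    exact BoundedMeasurable.lintegral_ne_top ⟨hgm, c, hc⟩ _
  refine ⟨fun g hg => ⟨_, ?_, (key g hg).2⟩, fun g hg w hw => ?_⟩
  · exact stronglyMeasurable_condExp.measurable.ennreal_ofReal
  · refine lintegral_mul_eq_of_setLIntegral_eq (filt.le z) hg.1 (hg.kernel _).1 hw fun A hA => ?_
    obtain ⟨hint, hae⟩ := key g hg
    rw [lintegral_congr_ae (ae_restrict_of_ae hae),
      ← ofReal_integral_eq_lintegral_ofReal integrable_condExp.integrableOn,
      setIntegral_condExp (filt.le z) hint hA,
      ofReal_integral_eq_lintegral_ofReal hint.integrableOn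
        (ae_of_all _ fun _ => ENNReal.toReal_nonneg)]
    · refine lintegral_congr fun x => (ENNReal.ofReal_toReal ?_).symm
      obtain ⟨-, c, hc⟩ := hg
      exact ne_top_of_le_ne_top ENNReal.coe_ne_top (hc x)
    · exact ae_restrict_of_ae (condExp_nonneg (ae_of_all _ fun _ => ENNReal.toReal_nonneg))

/-- The factors `∫ h j dk` agree `ν`-a.e. with `m`-measurable functions, so together with the
indicator of `C` they form an admissible weight. -/
lemma IsConditionalKernel.lintegral_indicator_mul_prod {E ι : Type*}
    {m : MeasurableSpace E} [MeasurableSpace E] {k : Kernel E E} {ν : Measure E}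
    (hk : IsConditionalKernel m k ν) {C : Set E} (hC : MeasurableSet[m] C) {g : E → ℝ≥0∞}
    (hg : BoundedMeasurable g) (t : Finset ι) {h : ι → E → ℝ≥0∞}
    (hh : ∀ j, BoundedMeasurable (h j)) :
    ∫⁻ x, C.indicator g x * ∏ j ∈ t, ∫⁻ y, h j y ∂(k x) ∂ν =
      ∫⁻ x, C.indicator (fun x => ∫⁻ y, g y ∂(k x)) x * ∏ j ∈ t, ∫⁻ y, h j y ∂(k x) ∂ν := by
  choose w hw hae using fun j => hk.exists_measurable (h j) (hh j)
  have hall : ∀ᵐ x ∂ν, ∀ j ∈ t, ∫⁻ y, h j y ∂(k x) = w j x :=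
    (ae_ball_iff t.countable_toSet).2 fun j _ => hae j
  have hW : Measurable[m] fun x => C.indicator (fun _ => 1) x * ∏ j ∈ t, w j x :=
    (measurable_const.indicator hC).mul (Finset.measurable_fun_prod _ fun j _ => hw j)
  have aux : ∀ f : E → ℝ≥0∞, ∫⁻ x, C.indicator f x * ∏ j ∈ t, ∫⁻ y, h j y ∂(k x) ∂ν =
      ∫⁻ x, (C.indicator (fun _ => 1) x * ∏ j ∈ t, w j x) * f x ∂ν := fun f => by
    refine lintegral_congr_ae ?_
    filter_upwards [hall] with x hx
    rw [Finset.prod_congr rfl hx]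
    by_cases hxC : x ∈ C <;> simp [hxC, mul_comm]
  rw [aux, aux, hk.lintegral_mul g hg _ hW]

/-! ### Conditional independence at a fixed level -/

lemma exists_inter_eq_of_comap_le {Ω : Type*} {m₁ m₂ : MeasurableSpace Ω} {S : Set Ω}
    (h : m₁.comap (Subtype.val : S → Ω) ≤ m₂.comap Subtype.val) {B : Set Ω}
    (hB : MeasurableSet[m₁] B) : ∃ B', MeasurableSet[m₂] B' ∧ B ∩ S = B' ∩ S := by
  obtain ⟨B', hB', he⟩ := h _ ⟨B, hB, rfl⟩
  refine ⟨B', hB', ?_⟩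
  ext ω
  refine and_congr_left fun hω => ?_
  exact (Set.ext_iff.1 he ⟨ω, hω⟩).symm

/-- Where the label set is constant, the random system lives in one component of the disjoint union,
so only the finite product σ-field matters there. -/
lemma comap_repSigma_le {Ω E : Type*} (𝓔 : MeasurableSpace E) {I : Ω → Finset ℕ}
    {Y : ℕ → Ω → E} {J : Finset ℕ} {S : Set Ω} (hS : S ⊆ {ω | I ω = J}) :
    (repSigma 𝓔 I Y).comap (Subtype.val : S → Ω) ≤
      (MeasurableSpace.comap (fun ω (n : J) => Y n ω)
        (@MeasurableSpace.pi _ (fun _ => E) (fun _ => 𝓔))).comap Subtype.val := by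
  have : repSystem I Y ∘ (Subtype.val : S → Ω) =
      Sigma.mk (β := fun J : Finset ℕ => J → E) J ∘ ((fun ω (n : J) => Y n ω) ∘ Subtype.val) := by
    funext ω
    have : ∀ J', J' = J → (⟨J', fun n => Y n ω⟩ : Σ J : Finset ℕ, (J → E)) =
        ⟨J, fun n => Y n ω⟩ := by
      rintro _ rfl; rfl
    exact this _ (hS ω.2)
  rw [repSigma, MeasurableSpace.comap_comp, MeasurableSpace.comap_comp, this,
    ← MeasurableSpace.comap_comp]
  refine MeasurableSpace.comap_mono (MeasurableSpace.comap_le_iff_le_map.2 ?_)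
  exact iInf_le _ J

lemma measurableSet_label {Ω E : Type*} (𝓔 : MeasurableSpace E) (I : Ω → Finset ℕ)
    (Y : ℕ → Ω → E) (s : Set (Finset ℕ)) : MeasurableSet[repSigma 𝓔 I Y] {ω | I ω ∈ s} := by
  refine ⟨{x | x.1 ∈ s}, ?_, rfl⟩
  refine MeasurableSpace.measurableSet_iInf.2 fun J => ?_
  rw [MeasurableSpace.map_def]
  exact @MeasurableSet.const _ (@MeasurableSpace.pi J (fun _ => E) fun _ => 𝓔) (J ∈ s)

/-- Given the σ-field `𝓐`, the replicas `(X n)_{n ∈ I}` are independent with respective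
laws `L n`. -/
def CondIndepWithLaws {Ω E : Type*} (𝓐 : MeasurableSpace Ω) [MeasurableSpace Ω]
    [MeasurableSpace E] (μ : Measure Ω) (I : Ω → Finset ℕ) (X : ℕ → Ω → E) (L : ℕ → Kernel Ω E) : Prop :=
  ∀ A, MeasurableSet[𝓐] A → ∀ (J : Finset ℕ) (g : ℕ → E → ℝ≥0∞), (∀ n, BoundedMeasurable (g n)) →
    ∫⁻ ω in A ∩ {ω | I ω = J}, ∏ n ∈ J, g n (X n ω) ∂μ =
      ∫⁻ ω in A ∩ {ω | I ω = J}, ∏ n ∈ J, ∫⁻ y, g n y ∂(L n ω) ∂μ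

section FixedLevel

variable {Ω E : Type*} {𝓐 : MeasurableSpace Ω} {m : MeasurableSpace E} [mΩ : MeasurableSpace Ω]
  [mE : MeasurableSpace E] {μ : Measure Ω} {I : Ω → Finset ℕ}
  {X : ℕ → Ω → E} {L : ℕ → Kernel Ω E} {k : Kernel E E} [IsMarkovKernel k]

/-- Each extra factor `j` is attached to the label `p j`, which turns both integrands into products
over `J` of functions of a single replica. Conditional independence replaces each replica by its law
`L n ω`, and the factors are compared one at a time, `k` being a conditional law under `L n ω`. -/
lemma CondIndepWithLaws.setLIntegral_prod_box (hR : CondIndepWithLaws 𝓐 μ I X L)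
    (hm : m ≤ mE) {C : Set Ω} (hk : ∀ᵐ ω ∂μ, ω ∈ C → ∀ n, IsConditionalKernel m k (L n ω))
    {A : Set Ω} (hA : MeasurableSet[𝓐] A) (hAm : MeasurableSet A) (hAC : A ⊆ C)
    {J T : Finset ℕ} (hJ : MeasurableSet {ω | I ω = J}) (hX : ∀ n, Measurable (X n)) {p : ℕ → ℕ}
    (hp : ∀ j ∈ T, p j ∈ J)
    {D : ℕ → Set E} (hD : ∀ n, MeasurableSet[m] (D n)) {g h : ℕ → E → ℝ≥0∞}
    (hg : ∀ n, BoundedMeasurable (g n)) (hh : ∀ n, BoundedMeasurable (h n)) :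
    ∫⁻ ω in (A ∩ {ω | I ω = J}) ∩ {ω | ∀ n ∈ J, X n ω ∈ D n},
      (∏ n ∈ J, g n (X n ω)) * ∏ j ∈ T, ∫⁻ y, h j y ∂(k (X (p j) ω)) ∂μ =
    ∫⁻ ω in (A ∩ {ω | I ω = J}) ∩ {ω | ∀ n ∈ J, X n ω ∈ D n},
      (∏ n ∈ J, ∫⁻ y, g n y ∂(k (X n ω))) * ∏ j ∈ T, ∫⁻ y, h j y ∂(k (X (p j) ω)) ∂μ := by
  classical
  have hbox : MeasurableSet {ω | ∀ n ∈ J, X n ω ∈ D n} := by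
    have : {ω | ∀ n ∈ J, X n ω ∈ D n} = ⋂ n ∈ J, X n ⁻¹' D n := by ext; simp
    rw [this]
    exact Finset.measurableSet_biInter _ fun n _ => hX n (hm _ (hD n))
  have aux : ∀ f : ℕ → E → ℝ≥0∞,
      ∫⁻ ω in (A ∩ {ω | I ω = J}) ∩ {ω | ∀ n ∈ J, X n ω ∈ D n},
        (∏ n ∈ J, f n (X n ω)) * ∏ j ∈ T, ∫⁻ y, h j y ∂(k (X (p j) ω)) ∂μ =
      ∫⁻ ω in A ∩ {ω | I ω = J}, ∏ n ∈ J, ((D n).indicator (f n) (X n ω) *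
        ∏ j ∈ T with p j = n, ∫⁻ y, h j y ∂(k (X n ω))) ∂μ := by
    intro f
    rw [← Set.inter_comm {ω | ∀ n ∈ J, X n ω ∈ D n}, ← Measure.restrict_restrict hbox,
      ← lintegral_indicator hbox]
    refine lintegral_congr fun ω => ?_
    rw [Finset.prod_mul_distrib]
    have h1 : ∏ n ∈ J, ∏ j ∈ T with p j = n, ∫⁻ y, h j y ∂(k (X n ω)) =
        ∏ j ∈ T, ∫⁻ y, h j y ∂(k (X (p j) ω)) := by
      rw [← Finset.prod_fiberwise_of_maps_to hp]
      refine Finset.prod_congr rfl fun n _ => Finset.prod_congr rfl fun j hj => ?_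
      rw [(Finset.mem_filter.1 hj).2]
    rw [h1]
    by_cases hω : ∀ n ∈ J, X n ω ∈ D n
    · rw [Set.indicator_of_mem (by exact hω)]
      congr 1
      exact Finset.prod_congr rfl fun n hn => (Set.indicator_of_mem (hω n hn) _).symm
    · rw [Set.indicator_of_notMem (by exact hω)]
      push Not at hω
      obtain ⟨n, hn, hnD⟩ := hω
      rw [Finset.prod_eq_zero hn (Set.indicator_of_notMem hnD _), zero_mul]
  have hw : ∀ n, BoundedMeasurable fun x => ∏ j ∈ T with p j = n, ∫⁻ y, h j y ∂(k x) := fun n =>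
    .prod _ fun j => (hh j).kernel k
  rw [aux, aux fun n x => ∫⁻ y, g n y ∂(k x),
    hR A hA J _ fun n => ((hg n).indicator (hm _ (hD n))).mul (hw n),
    hR A hA J _ fun n => (((hg n).kernel k).indicator (hm _ (hD n))).mul (hw n)]
  refine setLIntegral_congr_fun_ae (hAm.inter hJ) ?_
  filter_upwards [hk] with ω hω hωA
  refine Finset.prod_congr rfl fun n _ => ?_
  exact (hω (hAC hωA.1) n).lintegral_indicator_mul_prod (hD n) (hg n) _ hh

/-- Conditional independence is transported from the σ-field `𝓐` to the σ-field at a fixed level. -/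
lemma CondIndepWithLaws.setLIntegral_prod_level [IsFiniteMeasure μ]
    (hR : CondIndepWithLaws 𝓐 μ I X L)
    (h𝓐 : 𝓐 ≤ mΩ) (hm : m ≤ mE) {C : Set Ω} (hC : MeasurableSet[𝓐] C)
    (hk : ∀ᵐ ω ∂μ, ω ∈ C → ∀ n, IsConditionalKernel m k (L n ω))
    {B : Set Ω} (hB : MeasurableSet[𝓐 ⊔ repSigma m I X] B)
    {J T : Finset ℕ} (hJ : MeasurableSet {ω | I ω = J}) (hX : ∀ n, Measurable (X n)) {p : ℕ → ℕ}
    (hp : ∀ j ∈ T, p j ∈ J) {g h : ℕ → E → ℝ≥0∞}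
    (hg : ∀ n, BoundedMeasurable (g n)) (hh : ∀ n, BoundedMeasurable (h n)) :
    ∫⁻ ω in (B ∩ C) ∩ {ω | I ω = J},
      (∏ n ∈ J, g n (X n ω)) * ∏ j ∈ T, ∫⁻ y, h j y ∂(k (X (p j) ω)) ∂μ =
    ∫⁻ ω in (B ∩ C) ∩ {ω | I ω = J},
      (∏ n ∈ J, ∫⁻ y, g n y ∂(k (X n ω))) * ∏ j ∈ T, ∫⁻ y, h j y ∂(k (X (p j) ω)) ∂μ := by
  classical
  set XJ : Ω → (J → E) := fun ω n => X n ω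
  set 𝒟 : Set (Set (J → E)) := Set.pi Set.univ '' Set.pi Set.univ fun _ => {s | MeasurableSet[m] s}
  set 𝒞 : Set (Set Ω) := {s | ∃ t ∈ 𝒟, XJ ⁻¹' t = s}
  have hgen : (@MeasurableSpace.pi J (fun _ => E) (fun _ => m)).comap XJ =
      MeasurableSpace.generateFrom 𝒞 := by
    rw [← @generateFrom_pi J (fun _ => E) _ (fun _ => m), MeasurableSpace.comap_generateFrom]
    rfl
  have h𝒞 : IsPiSystem 𝒞 := (@isPiSystem_pi J (fun _ => E) (fun _ => m)).comap XJ
  have h𝒞m : MeasurableSpace.generateFrom 𝒞 ≤ mΩ := by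
    rw [← hgen]
    exact Measurable.comap_le ((@measurable_pi_iff Ω J _ mΩ (fun _ => m) XJ).2
      fun n => (hX n).mono le_rfl hm)
  have huniv : Set.univ ∈ 𝒞 := ⟨Set.univ, ⟨fun _ => Set.univ, by simp, by simp⟩, by simp⟩
  -- On `{I = J}` the event `B` can be exchanged for one generated by `𝓐` and boxes in the replicas
  -- of `J`; a π-system argument then leaves only boxes.
  have htr : (𝓐 ⊔ repSigma m I X).comap (Subtype.val : {ω | I ω = J} → Ω) ≤
      (𝓐 ⊔ MeasurableSpace.generateFrom 𝒞).comap Subtype.val := by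
    rw [MeasurableSpace.comap_sup, MeasurableSpace.comap_sup, ← hgen]
    exact sup_le_sup le_rfl (comap_repSigma_le m le_rfl)
  obtain ⟨B', hB', hBB'⟩ := exists_inter_eq_of_comap_le htr hB
  have hre : (B ∩ C) ∩ {ω | I ω = J} = (B' ∩ C) ∩ {ω | I ω = J} := by
    rw [Set.inter_right_comm, hBB', Set.inter_right_comm]
  have hB'm : MeasurableSet B' := sup_le h𝓐 h𝒞m _ hB'
  have hpre : ∀ B'' : Set Ω, MeasurableSet B'' → ∀ F : Ω → ℝ≥0∞,
      ∫⁻ ω in (B'' ∩ C) ∩ {ω | I ω = J}, F ω ∂μ =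
        ∫⁻ ω in B'', F ω ∂(μ.restrict (C ∩ {ω | I ω = J})) := fun B'' hB'' F => by
    rw [Measure.restrict_restrict hB'', Set.inter_assoc]
  rw [hre, hpre _ hB'm, hpre _ hB'm]
  have hbdd : BoundedMeasurable fun ω => (∏ n ∈ J, g n (X n ω)) *
      ∏ j ∈ T, ∫⁻ y, h j y ∂(k (X (p j) ω)) :=
    (BoundedMeasurable.prod J fun n => (hg n).comp (hX n)).mul
      (BoundedMeasurable.prod T fun j => ((hh j).kernel k).comp (hX (p j)))
  refine setLIntegral_eq_of_sup_generateFrom h𝓐 h𝒞 h𝒞m huniv (hbdd.lintegral_ne_top _) ?_ hB'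
  rintro A hA _ ⟨_, ⟨D, hD, rfl⟩, rfl⟩
  have hXD : XJ ⁻¹' Set.pi Set.univ D =
      {ω | ∀ n ∈ J, X n ω ∈ (if hn : n ∈ J then D ⟨n, hn⟩ else Set.univ)} := by
    ext ω
    simp +contextual [XJ]
  have hAm := h𝓐 _ hA
  have hXDm : MeasurableSet (XJ ⁻¹' Set.pi Set.univ D) :=
    h𝒞m _ (MeasurableSpace.measurableSet_generateFrom ⟨_, ⟨D, hD, rfl⟩, rfl⟩)
  have hset : (A ∩ XJ ⁻¹' Set.pi Set.univ D) ∩ (C ∩ {ω | I ω = J}) =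
      ((A ∩ C) ∩ {ω | I ω = J}) ∩ (XJ ⁻¹' Set.pi Set.univ D) := by
    ext; simp only [Set.mem_inter_iff]; tauto
  rw [Measure.restrict_restrict (hAm.inter hXDm), hset, hXD]
  refine hR.setLIntegral_prod_box hm hk (hA.inter hC) (hAm.inter (h𝓐 _ hC)) Set.inter_subset_right
    hJ hX hp (fun n => ?_) hg hh
  split_ifs with hn
  · exact hD ⟨n, hn⟩ (Set.mem_univ _)
  · exact .univ

end FixedLevel

/-! ### Resampling kernel at extended levels, right-continuity and discretization -/

open Classical in
/-- The family `levelKernel κ` as a kernel. -/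
noncomputable def resampleKernel {E : Type*} [MeasurableSpace E] (κ : Kernel (ℝ × E) E) :
    Kernel (WithTop ℝ × E) E :=
  Kernel.piecewise (s := Prod.fst ⁻¹' {⊤}) (measurable_fst (measurableSet_singleton _))
    (Kernel.deterministic Prod.snd measurable_snd)
    (κ.comap (fun p => (p.1.untopA, p.2)) (measurable_fst.untopA.prodMk measurable_snd))

section ResampleKernel

variable {E : Type*} [MeasurableSpace E] (κ : Kernel (ℝ × E) E)

lemma resampleKernel_coe (z : ℝ) (x : E) : resampleKernel κ ((z : WithTop ℝ), x) = κ (z, x) := by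
  classical
  rw [resampleKernel, Kernel.piecewise_apply, if_neg (by simp)]
  rfl

lemma resampleKernel_top (x : E) : resampleKernel κ (⊤, x) = Measure.dirac x := by
  classical
  rw [resampleKernel, Kernel.piecewise_apply, if_pos (by simp), Kernel.deterministic_apply]

lemma resampleKernel_apply (z : WithTop ℝ) (x : E) :
    resampleKernel κ (z, x) = levelKernel κ z x := by
  cases z with
  | top => exact resampleKernel_top κ x
  | coe z => exact resampleKernel_coe κ z x

instance [IsMarkovKernel κ] : IsMarkovKernel (resampleKernel κ) := by
  rw [resampleKernel]; infer_instance

end ResampleKernel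

/-- Right-continuity in the level, for integrals with values in `[0, ∞]`. -/
lemma RightContinuousKernel.continuousWithinAt_lintegral {E : Type*} [TopologicalSpace E]
    [MeasurableSpace E] [OpensMeasurableSpace E] {π : Measure E} {κ : Kernel (ℝ × E) E}
    [IsMarkovKernel κ] (h : RightContinuousKernel π κ) (f : E →ᵇ ℝ≥0) (x : E) (z : ℝ) :
    ContinuousWithinAt (fun z' : ℝ => ∫⁻ y, f y ∂(κ (z', x))) (Set.Ici z) z := by
  set φ : E →ᵇ ℝ := BoundedContinuousFunction.ofNormedAddCommGroup (fun y => (f y : ℝ))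
    (NNReal.continuous_coe.comp f.continuous) (nndist f 0) fun y => by
      rw [Real.norm_of_nonneg (f y).coe_nonneg]
      exact NNReal.coe_le_coe.2 (BoundedContinuousFunction.NNReal.upper_bound f y)
  have heq : ∀ z' : ℝ, ∫⁻ y, f y ∂(κ (z', x)) = ENNReal.ofReal (∫ y, φ y ∂(κ (z', x))) := fun z' =>
    lintegral_coe_eq_integral _ (φ.integrable _)
  simp_rw [heq]
  exact ENNReal.continuous_ofReal.continuousAt.comp_continuousWithinAt ((h x φ).1 z)

/-- The least multiple of `1 / (k + 1)` larger than `z`. -/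
noncomputable def gridAbove (k : ℕ) (z : ℝ) : ℝ := ((⌊((k : ℝ) + 1) * z⌋ : ℝ) + 1) / ((k : ℝ) + 1)

lemma lt_gridAbove (k : ℕ) (z : ℝ) : z < gridAbove k z := by
  rw [gridAbove, lt_div_iff₀ (by positivity), mul_comm]
  exact Int.lt_floor_add_one _

lemma gridAbove_le (k : ℕ) (z : ℝ) : gridAbove k z ≤ z + 1 / ((k : ℝ) + 1) := by
  have h : (0 : ℝ) < k + 1 := by positivity
  have h' : (⌊((k : ℝ) + 1) * z⌋ : ℝ) ≤ (k + 1) * z := Int.floor_le _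
  rw [gridAbove, div_le_iff₀ h, add_mul z, one_div, inv_mul_cancel₀ h.ne', mul_comm z]
  linarith

lemma tendsto_gridAbove (z : ℝ) : Tendsto (fun k => gridAbove k z) atTop (𝓝[≥] z) := by
  refine tendsto_nhdsWithin_iff.2 ⟨?_, Eventually.of_forall fun k => (lt_gridAbove k z).le⟩
  refine tendsto_of_tendsto_of_tendsto_of_le_of_le tendsto_const_nhds ?_
    (fun k => (lt_gridAbove k z).le) fun k => gridAbove_le k z
  simpa using tendsto_const_nhds.add (tendsto_one_div_add_atTop_nhds_zero_nat (𝕜 := ℝ))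

lemma measurable_gridAbove (k : ℕ) : Measurable (gridAbove k) := by
  unfold gridAbove; fun_prop

/-! ### Conditional independence at a stopping level -/

section Stopping

variable {Ω E : Type*} {𝓐 : MeasurableSpace Ω} [mΩ : MeasurableSpace Ω] [TopologicalSpace E]
  [mE : MeasurableSpace E] [BorelSpace E] {μ : Measure Ω} [IsFiniteMeasure μ] {I : Ω → Finset ℕ}
  {X : ℕ → Ω → E} {L : ℕ → Kernel Ω E} {π : Measure E} {κ : Kernel (ℝ × E) E}
  [IsMarkovKernel κ] {filt : Filtration ℝ mE} {F : Filtration ℝ mΩ} {Z : Ω → WithTop ℝ}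

lemma CondIndepWithLaws.setLIntegral_prod_stopped_continuous (hR : CondIndepWithLaws 𝓐 μ I X L)
    (h𝓐 : 𝓐 ≤ mΩ) (hX : ∀ n, Measurable (X n)) (hright : RightContinuousKernel π κ)
    (hF : ∀ z, F z = 𝓐 ⊔ repSigma (filt z) I X) (hZ : IsStoppingTime F Z)
    {C : ℝ → Set Ω} (hC : ∀ z, MeasurableSet[𝓐] (C z))
    (hk : ∀ z, ∀ᵐ ω ∂μ, ω ∈ C z → ∀ n, IsConditionalKernel (filt z) (κ.sectR z) (L n ω))
    (hZC : ∀ z : ℝ, ∀ᵐ ω ∂μ, Z ω ≤ z → ω ∈ C z) {A : Set Ω}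
    (hA : MeasurableSet[hZ.measurableSpace] A) {J T : Finset ℕ}
    (hJ : MeasurableSet {ω | I ω = J}) {p : ℕ → ℕ} (hp : ∀ j ∈ T, p j ∈ J)
    (f g : ℕ → E →ᵇ ℝ≥0) :
    ∫⁻ ω in A ∩ {ω | I ω = J}, (∏ n ∈ J, (f n (X n ω) : ℝ≥0∞)) *
        ∏ j ∈ T, ∫⁻ y, g j y ∂(resampleKernel κ (Z ω, X (p j) ω)) ∂μ =
      ∫⁻ ω in A ∩ {ω | I ω = J}, (∏ n ∈ J, ∫⁻ y, f n y ∂(resampleKernel κ (Z ω, X n ω))) *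
        ∏ j ∈ T, ∫⁻ y, g j y ∂(resampleKernel κ (Z ω, X (p j) ω)) ∂μ := by
  have hZm : Measurable Z := hZ.measurable.mono hZ.measurableSpace_le le_rfl
  have hAm : MeasurableSet A := hZ.measurableSpace_le _ hA
  have htop : MeasurableSet {ω | Z ω = ⊤} := hZm (measurableSet_singleton _)
  have htop' : MeasurableSet[hZ.measurableSpace] {ω | Z ω = ⊤} :=
    hZ.measurable (measurableSet_singleton _)
  rw [← lintegral_inter_add_sdiff _ _ htop,
    ← lintegral_inter_add_sdiff (fun ω => (∏ n ∈ J, ∫⁻ y, f n y ∂(resampleKernel κ (Z ω, X n ω))) *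
        ∏ j ∈ T, ∫⁻ y, g j y ∂(resampleKernel κ (Z ω, X (p j) ω))) _ htop]
  congr 1
  -- At level `⊤` the resampling kernel is a Dirac mass, so the two integrands coincide.
  · refine setLIntegral_congr_fun ((hAm.inter hJ).inter htop) fun ω hω => ?_
    have hω : Z ω = ⊤ := hω.2
    simp only [hω, resampleKernel_top]
    congr 1
    refine Finset.prod_congr rfl fun n _ => ?_
    rw [lintegral_dirac' _ (BoundedMeasurable.continuous (f n)).1]
  set S := (A ∩ {ω | I ω = J}) \ {ω | Z ω = ⊤}
  have hSm : MeasurableSet S := (hAm.inter hJ).diff htop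
  have hZS : ∀ ω ∈ S, ((Z ω).untopA : WithTop ℝ) = Z ω := fun ω hω => by
    rw [WithTop.untopA_eq_untop hω.2, WithTop.coe_untop]
  have hZr : Measurable fun ω => (Z ω).untopA := hZm.untopA
  have hf := fun n => BoundedMeasurable.continuous (f n)
  have hg := fun n => BoundedMeasurable.continuous (g n)
  have hgrid : ∀ k, Measurable fun ω => gridAbove k (Z ω).untopA := fun k =>
    (measurable_gridAbove k).comp hZr
  have hcg : ∀ ζ : Ω → ℝ, Measurable ζ → BoundedMeasurable fun ω =>
      ∏ j ∈ T, ∫⁻ y, g j y ∂(κ (ζ ω, X (p j) ω)) := fun ζ hζ =>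
    .prod _ fun j => ((hg j).kernel κ).comp (hζ.prodMk (hX _))
  have hcf : ∀ ζ : Ω → ℝ, Measurable ζ → BoundedMeasurable fun ω =>
      ∏ j ∈ J, ∫⁻ y, f j y ∂(κ (ζ ω, X j ω)) := fun ζ hζ =>
    .prod _ fun j => ((hf j).kernel κ).comp (hζ.prodMk (hX _))
  have hcX : BoundedMeasurable fun ω => ∏ n ∈ J, (f n (X n ω) : ℝ≥0∞) :=
    .prod _ fun j => (hf j).comp (hX _)
  -- The claim with `Z` replaced by its grid approximation: on a cell where the latter equals `z`
  -- one has `Z ≤ z`, so the cell intersected with `A` belongs to `F z` and the fixed-level result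
  -- applies.
  have hgridint : ∀ k, ∫⁻ ω in S, (∏ n ∈ J, (f n (X n ω) : ℝ≥0∞)) *
        ∏ j ∈ T, ∫⁻ y, g j y ∂(κ (gridAbove k (Z ω).untopA, X (p j) ω)) ∂μ =
      ∫⁻ ω in S, (∏ n ∈ J, ∫⁻ y, f n y ∂(κ (gridAbove k (Z ω).untopA, X n ω))) *
        ∏ j ∈ T, ∫⁻ y, g j y ∂(κ (gridAbove k (Z ω).untopA, X (p j) ω)) ∂μ := by
    intro k
    refine setLIntegral_eq_of_forall_fiber (Y := fun ω => ⌊((k : ℝ) + 1) * (Z ω).untopA⌋)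
      (fun y => ?_) hSm fun y => ?_
    · have : Measurable fun ω => ⌊((k : ℝ) + 1) * (Z ω).untopA⌋ := by fun_prop
      exact this (measurableSet_singleton y)
    set z : ℝ := ((y : ℝ) + 1) / ((k : ℝ) + 1)
    have hYm : MeasurableSet[hZ.measurableSpace] {ω | ⌊((k : ℝ) + 1) * (Z ω).untopA⌋ = y} := by
      have h1 : Measurable fun a : WithTop ℝ => ⌊((k : ℝ) + 1) * a.untopA⌋ := by fun_prop
      exact (h1.comp hZ.measurable) (measurableSet_singleton y)
    set B := A ∩ {ω | Z ω = ⊤}ᶜ ∩ {ω | ⌊((k : ℝ) + 1) * (Z ω).untopA⌋ = y}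
    have hBZ : ∀ ω ∈ B, Z ω ≤ z := fun ω hω => by
      have h1 : ((Z ω).untopA : WithTop ℝ) = Z ω := by
        rw [WithTop.untopA_eq_untop hω.1.2, WithTop.coe_untop]
      have h2 : gridAbove k (Z ω).untopA = z := by
        have : ⌊((k : ℝ) + 1) * (Z ω).untopA⌋ = y := hω.2
        rw [gridAbove, this]
      rw [← h1, ← h2]
      exact WithTop.coe_le_coe.2 (lt_gridAbove _ _).le
    have hBF : MeasurableSet[F z] B := by
      have hBz : B ∩ {ω | Z ω ≤ z} = B := Set.inter_eq_left.2 fun ω hω => hBZ ω hω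
      rw [← hBz]
      exact ((hA.inter htop'.compl).inter hYm).2 z
    have hset : S ∩ {ω | ⌊((k : ℝ) + 1) * (Z ω).untopA⌋ = y} = B ∩ {ω | I ω = J} := by
      ext; simp only [S, B, Set.mem_inter_iff, Set.mem_sdiff, Set.mem_compl_iff]; tauto
    -- Intersecting with `C z`, where the prior laws are consistent at level `z`, costs nothing
    -- since `Z ≤ z` on `B`.
    have hset' : (B ∩ {ω | I ω = J} : Set Ω) =ᵐ[μ] ((B ∩ C z) ∩ {ω | I ω = J} : Set Ω) := by
      filter_upwards [hZC z] with ω hω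
      refine propext ⟨fun h => ⟨⟨h.1, hω (hBZ ω h.1)⟩, h.2⟩, fun h => ⟨h.1.1, h.2⟩⟩
    have hcongr : ∀ Φ : ℝ → Ω → ℝ≥0∞,
        ∫⁻ ω in B ∩ {ω | I ω = J}, Φ (gridAbove k (Z ω).untopA) ω ∂μ =
          ∫⁻ ω in (B ∩ C z) ∩ {ω | I ω = J}, Φ z ω ∂μ := fun Φ => by
      rw [← setLIntegral_congr hset']
      refine setLIntegral_congr_fun ((F.le z _ hBF).inter hJ) fun ω hω => ?_
      have : ⌊((k : ℝ) + 1) * (Z ω).untopA⌋ = y := hω.1.2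
      simp only [gridAbove, this, z]
    rw [hset, hcongr fun z ω => (∏ n ∈ J, (f n (X n ω) : ℝ≥0∞)) *
        ∏ j ∈ T, ∫⁻ y, g j y ∂(κ (z, X (p j) ω)),
      hcongr fun z ω => (∏ n ∈ J, ∫⁻ y, f n y ∂(κ (z, X n ω))) *
        ∏ j ∈ T, ∫⁻ y, g j y ∂(κ (z, X (p j) ω))]
    rw [hF z] at hBF
    exact hR.setLIntegral_prod_level h𝓐 (filt.le z) (hC z) (hk z) hBF hJ hX hp hf hg
  -- The grid approaches `Z` from above, so right-continuity suffices.
  have hlim : ∀ ω ∈ S, ∀ (h : E →ᵇ ℝ≥0) (x : E), Tendsto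
      (fun k => ∫⁻ y, h y ∂(κ (gridAbove k (Z ω).untopA, x))) atTop
      (𝓝 (∫⁻ y, h y ∂(resampleKernel κ (Z ω, x)))) := fun ω hω h x => by
    rw [← hZS ω hω, resampleKernel_coe]
    exact (hright.continuousWithinAt_lintegral h x _).tendsto.comp (tendsto_gridAbove _)
  have hbd : ∀ (s : Finset ℕ) (h : ℕ → E →ᵇ ℝ≥0), ∃ c : ℝ≥0, ∀ (ρ : ℕ → ProbabilityMeasure E),
      ∏ j ∈ s, ∫⁻ y, h j y ∂(ρ j : Measure E) ≤ c := fun s h => by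
    choose c hc using fun j => (BoundedMeasurable.continuous (h j)).2
    refine ⟨∏ j ∈ s, c j, fun ρ => ?_⟩
    push_cast
    exact Finset.prod_le_prod' fun j _ => (lintegral_mono (hc j)).trans (by simp)
  have hne : ∀ (s : Finset ℕ) (h : ℕ → E →ᵇ ℝ≥0) (ρ : ℕ → Measure E)
      [∀ j, IsProbabilityMeasure (ρ j)], ∏ j ∈ s, ∫⁻ y, h j y ∂(ρ j) ≠ ∞ := fun s h ρ _ =>
    ENNReal.prod_ne_top fun j _ => (BoundedMeasurable.continuous (h j)).lintegral_ne_top _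
  obtain ⟨cf, hcf'⟩ := hbd J f
  obtain ⟨cg, hcg'⟩ := hbd T g
  obtain ⟨-, cX, hcX'⟩ := id hcX
  have hl1 : Tendsto (fun k => ∫⁻ ω in S, (∏ n ∈ J, (f n (X n ω) : ℝ≥0∞)) *
        ∏ j ∈ T, ∫⁻ y, g j y ∂(κ (gridAbove k (Z ω).untopA, X (p j) ω)) ∂μ) atTop
      (𝓝 (∫⁻ ω in S, (∏ n ∈ J, (f n (X n ω) : ℝ≥0∞)) *
        ∏ j ∈ T, ∫⁻ y, g j y ∂(resampleKernel κ (Z ω, X (p j) ω)) ∂μ)) := by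
    refine tendsto_lintegral_of_dominated_convergence (fun _ => (cX : ℝ≥0∞) * cg)
      (fun k => hcX.1.mul (hcg _ (hgrid k)).1) (fun k => ae_of_all _ fun ω => ?_)
      (by simp [ENNReal.mul_eq_top]) ?_
    · exact mul_le_mul' (hcX' ω) (hcg' fun j => ⟨κ _, inferInstance⟩)
    · filter_upwards [ae_restrict_mem hSm] with ω hω
      refine ENNReal.Tendsto.const_mul (ENNReal.tendsto_finsetProd_of_ne_top _
        (fun j _ => hlim ω hω (g j) _) fun j _ => ?_) (Or.inr ?_)
      · exact (hg j).lintegral_ne_top _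
      · exact ne_top_of_le_ne_top ENNReal.coe_ne_top (hcX' ω)
  have hl2 : Tendsto (fun k => ∫⁻ ω in S,
        (∏ n ∈ J, ∫⁻ y, f n y ∂(κ (gridAbove k (Z ω).untopA, X n ω))) *
        ∏ j ∈ T, ∫⁻ y, g j y ∂(κ (gridAbove k (Z ω).untopA, X (p j) ω)) ∂μ) atTop
      (𝓝 (∫⁻ ω in S, (∏ n ∈ J, ∫⁻ y, f n y ∂(resampleKernel κ (Z ω, X n ω))) *
        ∏ j ∈ T, ∫⁻ y, g j y ∂(resampleKernel κ (Z ω, X (p j) ω)) ∂μ)) := by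
    refine tendsto_lintegral_of_dominated_convergence (fun _ => (cf : ℝ≥0∞) * cg)
      (fun k => (hcf _ (hgrid k)).1.mul (hcg _ (hgrid k)).1) (fun k => ae_of_all _ fun ω => ?_)
      (by simp [ENNReal.mul_eq_top]) ?_
    · exact mul_le_mul' (hcf' fun j => ⟨κ _, inferInstance⟩) (hcg' fun j => ⟨κ _, inferInstance⟩)
    · filter_upwards [ae_restrict_mem hSm] with ω hω
      refine ENNReal.Tendsto.mul (ENNReal.tendsto_finsetProd_of_ne_top _
        (fun j _ => hlim ω hω (f j) _) fun j _ => (hf j).lintegral_ne_top _) (Or.inr (hne T g _))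
        (ENNReal.tendsto_finsetProd_of_ne_top _
        (fun j _ => hlim ω hω (g j) _) fun j _ => (hg j).lintegral_ne_top _) (Or.inr (hne J f _))
  exact tendsto_nhds_unique hl1 (by simpa only [hgridint] using hl2)

/-- Conditional independence is transported from the σ-field `𝓐` to the σ-field stopped at `Z`.
Since integrals against the resampling kernel at a random level need not be measurable with respect
to the stopped σ-field, they are allowed as additional factors. -/
lemma CondIndepWithLaws.setLIntegral_prod_stopped [HasOuterApproxClosed E]
    (hR : CondIndepWithLaws 𝓐 μ I X L)
    (h𝓐 : 𝓐 ≤ mΩ) (hX : ∀ n, Measurable (X n)) (hright : RightContinuousKernel π κ)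
    (hF : ∀ z, F z = 𝓐 ⊔ repSigma (filt z) I X) (hZ : IsStoppingTime F Z)
    {C : ℝ → Set Ω} (hC : ∀ z, MeasurableSet[𝓐] (C z))
    (hk : ∀ z, ∀ᵐ ω ∂μ, ω ∈ C z → ∀ n, IsConditionalKernel (filt z) (κ.sectR z) (L n ω))
    (hZC : ∀ z : ℝ, ∀ᵐ ω ∂μ, Z ω ≤ z → ω ∈ C z) {A : Set Ω}
    (hA : MeasurableSet[hZ.measurableSpace] A) {J T : Finset ℕ}
    (hJ : MeasurableSet {ω | I ω = J}) {p : ℕ → ℕ} (hp : ∀ j ∈ T, p j ∈ J)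
    {g h : ℕ → E → ℝ≥0∞} (hg : ∀ n, BoundedMeasurable (g n)) (hh : ∀ n, BoundedMeasurable (h n)) :
    ∫⁻ ω in A ∩ {ω | I ω = J}, (∏ n ∈ J, g n (X n ω)) *
        ∏ j ∈ T, ∫⁻ y, h j y ∂(resampleKernel κ (Z ω, X (p j) ω)) ∂μ =
      ∫⁻ ω in A ∩ {ω | I ω = J}, (∏ n ∈ J, ∫⁻ y, g n y ∂(resampleKernel κ (Z ω, X n ω))) *
        ∏ j ∈ T, ∫⁻ y, h j y ∂(resampleKernel κ (Z ω, X (p j) ω)) ∂μ := by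
  have hZm : Measurable Z := hZ.measurable.mono hZ.measurableSpace_le le_rfl
  set b : ℕ → Kernel Ω E := fun n =>
    (resampleKernel κ).comap (fun ω => (Z ω, X n ω)) (hZm.prodMk (hX n))
  -- Left indices are the replicas: a Dirac mass at `X n` in `a₁`, the resampling kernel in `a₂`.
  -- Right indices are the additional factors, equal on both sides. The claim becomes an equality of
  -- mixtures of kernel products, already known for continuous functions.
  set a₁ : ℕ ⊕ ℕ → Kernel Ω E :=
    Sum.elim (fun n => Kernel.deterministic (X n) (hX n)) fun j => b (p j)
  set a₂ : ℕ ⊕ ℕ → Kernel Ω E := Sum.elim b fun j => b (p j)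
  have hb : ∀ n, IsMarkovKernel (b n) := fun n => by simp only [b]; infer_instance
  have ha₁ : ∀ i, IsMarkovKernel (a₁ i) := by
    rintro (n | j)
    · simp only [a₁, Sum.elim_inl]; infer_instance
    · exact hb _
  have ha₂ : ∀ i, IsMarkovKernel (a₂ i) := by
    rintro (n | j) <;> exact hb _
  have e₁ : ∀ u : ℕ ⊕ ℕ → E → ℝ≥0∞, (∀ i, BoundedMeasurable (u i)) → ∀ ω,
      ∏ i ∈ J.disjSum T, ∫⁻ y, u i y ∂(a₁ i ω) = (∏ n ∈ J, u (.inl n) (X n ω)) *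
        ∏ j ∈ T, ∫⁻ y, u (.inr j) y ∂(resampleKernel κ (Z ω, X (p j) ω)) := fun u hu ω => by
    rw [Finset.prod_disjSum]
    congr 1
    refine Finset.prod_congr rfl fun n _ => ?_
    simp only [a₁, Sum.elim_inl, Kernel.deterministic_apply, lintegral_dirac' _ (hu _).1]
  have e₂ : ∀ u : ℕ ⊕ ℕ → E → ℝ≥0∞, ∀ ω,
      ∏ i ∈ J.disjSum T, ∫⁻ y, u i y ∂(a₂ i ω) =
        (∏ n ∈ J, ∫⁻ y, u (.inl n) y ∂(resampleKernel κ (Z ω, X n ω))) *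
        ∏ j ∈ T, ∫⁻ y, u (.inr j) y ∂(resampleKernel κ (Z ω, X (p j) ω)) := fun u ω => by
    rw [Finset.prod_disjSum]
    rfl
  have key := lintegral_prod_kernel_eq_of_continuous (ν := μ.restrict (A ∩ {ω | I ω = J}))
    (s := J.disjSum T) (a := a₁) (b := a₂) (fun f => ?_) (g := Sum.elim g h)
    (by rintro (n | j); exacts [hg n, hh j])
  · simp only [e₂, e₁ (Sum.elim g h) (by rintro (n | j); exacts [hg n, hh j])] at key
    exact key
  · simp only [e₂ fun i y => f i y, e₁ (fun i y => f i y) fun i => .continuous (f i)]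
    exact hR.setLIntegral_prod_stopped_continuous h𝓐 hX hright hF hZ hC hk hZC hA hJ hp
      (fun n => f (.inl n)) fun j => f (.inr j)

end Stopping

/-! ### Measurability for random label sets and freezing of independent variables -/

lemma repSigma_le {Ω E : Type*} [mΩ : MeasurableSpace Ω] [mE : MeasurableSpace E]
    {I : Ω → Finset ℕ} {Y : ℕ → Ω → E} (hI : ∀ J, MeasurableSet {ω | I ω = J})
    (hY : ∀ n, Measurable (Y n)) : repSigma mE I Y ≤ mΩ := by
  rintro _ ⟨s, hs, rfl⟩
  have : repSystem I Y ⁻¹' s = ⋃ J : Finset ℕ, {ω | I ω = J} ∩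
      {ω | (⟨J, fun n => Y n ω⟩ : Σ J : Finset ℕ, (J → E)) ∈ s} := by
    ext ω
    simp [repSystem]
  rw [this]
  refine .iUnion fun J => (hI J).inter ?_
  have h1 : Measurable (fun ω (n : J) => Y n ω) := by fun_prop
  exact h1 (MeasurableSpace.measurableSet_iInf.1 hs J)

lemma repSigma_mono {Ω E : Type*} {𝓔 𝓔' : MeasurableSpace E} (h : 𝓔 ≤ 𝓔') (I : Ω → Finset ℕ) 
    (Y : ℕ → Ω → E) :
    repSigma 𝓔 I Y ≤ repSigma 𝓔' I Y :=
  MeasurableSpace.comap_mono (iInf_mono fun _ =>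
    MeasurableSpace.map_mono (iSup_mono fun _ => MeasurableSpace.comap_mono h))

open Classical in
/-- The replica with label `n`, replaced by `e` if `n` is not a label. -/
noncomputable def restrictLabels {Ω E : Type*} (e : E) (I : Ω → Finset ℕ) (Y : ℕ → Ω → E) (n : ℕ)
    (ω : Ω) : E :=
  if n ∈ I ω then Y n ω else e

lemma restrictLabels_of_mem {Ω E : Type*} {e : E} {I : Ω → Finset ℕ} {Y : ℕ → Ω → E} {n : ℕ}
    {ω : Ω} (h : n ∈ I ω) : restrictLabels e I Y n ω = Y n ω :=
  if_pos h

/-- The constant `e` erases the values at absent labels, about which `repSigma` carries no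
information. -/
lemma measurable_restrictLabels {Ω E : Type*} (𝓔 : MeasurableSpace E) (e : E) (I : Ω → Finset ℕ)
    (Y : ℕ → Ω → E) (n : ℕ) : Measurable[repSigma 𝓔 I Y] (restrictLabels e I Y n) := by
  classical
  have h1 : Measurable[repSpace 𝓔] fun x : Σ J : Finset ℕ, (J → E) =>
      if h : n ∈ x.1 then x.2 ⟨n, h⟩ else e := by
    intro s hs
    refine MeasurableSpace.measurableSet_iInf.2 fun J => ?_
    rw [MeasurableSpace.map_def]
    by_cases h : n ∈ J
    · convert! (@measurable_pi_apply J (fun _ => E) (fun _ => 𝓔) ⟨n, h⟩) hs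
      ext; simp [h]
    · have : Sigma.mk J ⁻¹' ((fun x : Σ J : Finset ℕ, (J → E) =>
          if h : n ∈ x.1 then x.2 ⟨n, h⟩ else e) ⁻¹' s) = {_x : J → E | e ∈ s} := by
        ext; simp [h]
      rw [this]
      exact MeasurableSet.const _
  have h2 : restrictLabels e I Y n = (fun x : Σ J : Finset ℕ, (J → E) =>
      if h : n ∈ x.1 then x.2 ⟨n, h⟩ else e) ∘ repSystem I Y := by
    funext ω
    by_cases h : n ∈ I ω <;> simp [restrictLabels, repSystem, h]
  rw [h2]
  exact h1.comp (comap_measurable _)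

lemma measurable_apply_index {Ω β : Type*} {m : MeasurableSpace Ω} [MeasurableSpace β]
    {f : ℕ → Ω → β} (hf : ∀ n, Measurable (f n)) {N : Ω → ℕ} (hN : Measurable N) :
    Measurable fun ω => f (N ω) ω :=
  (measurable_from_prod_countable_right (f := fun x : ℕ × Ω => f x.1 x.2) hf).comp
    (hN.prodMk measurable_id)

/-- Conditional mean given `m` of a function of `m` and of an independent variable. -/
lemma exists_measurable_lintegral_mul_eq {Ω β : Type*} {m H : MeasurableSpace Ω}
    [mΩ : MeasurableSpace Ω] [mβ : MeasurableSpace β] {μ : Measure Ω} [IsProbabilityMeasure μ]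
    (hm : m ≤ H) (hH : H ≤ mΩ) {U : Ω → β} (hU : Measurable U)
    (hind : Indep (MeasurableSpace.comap U mβ) H μ) {ψ : Ω × β → ℝ≥0∞}
    (hψ : Measurable[m.prod mβ] ψ) :
    ∃ d : Ω → ℝ≥0∞, Measurable[m] d ∧ ∀ W : Ω → ℝ≥0∞, Measurable[H] W →
      ∫⁻ ω, ψ (ω, U ω) * W ω ∂μ = ∫⁻ ω, d ω * W ω ∂μ := by
  have := Measure.isProbabilityMeasure_map (μ := μ) hU.aemeasurable
  -- Averaging over `U` alone leaves an `m`-measurable function, while independence from the larger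
  -- `H` allows any `H`-measurable weight.
  refine ⟨fun ω => ∫⁻ u, ψ (ω, u) ∂(μ.map U),
    @Measurable.lintegral_prod_right' _ _ m mβ _ _ _ hψ, fun W hW => ?_⟩
  have hψH : Measurable[H.prod mβ] ψ :=
    hψ.mono (sup_le_sup (MeasurableSpace.comap_mono hm) le_rfl) le_rfl
  have hWH : Measurable[H.prod mβ] fun x : Ω × β => W x.1 :=
    hW.comp (@measurable_fst _ _ H mβ)
  have hmul : Measurable[H.prod mβ] fun x : Ω × β => ψ x * W x.1 := hψH.mul hWH
  rw [lintegral_comp_of_indep (h := fun x => ψ x * W x.1) hH hU hind hmul]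
  refine lintegral_congr fun ω => ?_
  have h1 : Measurable fun u => ψ (ω, u) :=
    hψ.comp (@measurable_prodMk_left _ _ m mβ ω)
  exact lintegral_mul_const (W ω) h1

/-- The labels obtained from the labels `J` when the branching numbers are `v`. -/
def nextLabels (J : Finset ℕ) (v : ℕ → ℕ) : Finset ℕ :=
  (J.filter fun n => v n ≠ 0) ∪ Finset.Icc (J.sup id + 1) (J.sup id + ∑ n ∈ J, (v n - 1))

lemma nextLabels_congr {J : Finset ℕ} {v w : ℕ → ℕ} (h : ∀ n ∈ J, v n = w n) :
    nextLabels J v = nextLabels J w := by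
  have h1 : (J.filter fun n => v n ≠ 0) = J.filter fun n => w n ≠ 0 :=
    Finset.filter_congr fun n hn => by rw [h n hn]
  rw [nextLabels, nextLabels, h1, Finset.sum_congr rfl fun n hn => by rw [h n hn]]

/-- Only the coordinates in `J` matter, and `J → ℕ` is countable and discrete. -/
lemma measurableSet_nextLabels_eq {α : Type*} [MeasurableSpace α] (J J' : Finset ℕ)
    {b : ℕ → α → ℕ} (hb : ∀ n, Measurable (b n)) :
    MeasurableSet {x | nextLabels J (fun n => b n x) = J'} := by
  classical
  have h1 : Measurable fun (x : α) (n : J) => b n x := by fun_prop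
  have h2 : {x | nextLabels J (fun n => b n x) = J'} = (fun (x : α) (n : J) => b n x) ⁻¹'
      {v | nextLabels J (fun n => if h : n ∈ J then v ⟨n, h⟩ else 0) = J'} := by
    ext x
    have := nextLabels_congr (J := J) (v := fun n => b n x)
      (w := fun n => if h : n ∈ J then b n x else 0) fun n hn => by simp [hn]
    simp only [Set.mem_ofPred_eq, Set.mem_preimage, this]
  rw [h2]
  exact h1 (Set.to_countable _).measurableSet

namespace SplittingData

lemma lt_of_mem_newLabels {Ω E : Type*} [MeasurableSpace Ω] (D : SplittingData Ω E) {q : ℕ} {ω : Ω} {n m : ℕ} (hn : n ∈ D.newLabels q ω)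
    (hm : m ∈ D.I q ω) : m < n := by
  have h1 := (Finset.mem_Icc.1 hn).1
  have h2 : m ≤ (D.I q ω).sup id := Finset.le_sup (f := id) hm
  omega

end SplittingData

/-! ### The σ-fields of the algorithm, prior laws and initialization -/

namespace IsGAMS

variable {Ω E : Type*} [mΩ : MeasurableSpace Ω] [mE : MeasurableSpace E] {μ : Measure Ω}
  {π : Measure E} {filt : Filtration ℝ mE} {κ : Kernel (ℝ × E) E} {D : SplittingData Ω E}

/-- The σ-field `𝓕 q` after the stopping step of iteration `q`. -/
abbrev stopped (hD : IsGAMS μ π filt κ D) (q : ℕ) : MeasurableSpace Ω :=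
  (hD.Z_stopping q).measurableSpace

/-- The σ-field generated by the variables introduced before the replicas of iteration `q`. -/
@[reducible] def priorSigma (hD : IsGAMS μ π filt κ D) : ℕ → MeasurableSpace Ω
  | 0 => ⊥
  | q + 1 => hD.stopped q ⊔ D.parentSigma q

lemma F_eq (hD : IsGAMS μ π filt κ D) (q : ℕ) (z : ℝ) :
    D.F q z = hD.priorSigma q ⊔ repSigma (filt z) (D.I q) (D.X q) := by
  cases q with
  | zero => rw [hD.F_zero, priorSigma, bot_sup_eq]
  | succ q => exact hD.F_succ q z

lemma stopped_le (hD : IsGAMS μ π filt κ D) (q : ℕ) : hD.stopped q ≤ mΩ :=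
  (hD.Z_stopping q).measurableSpace_le

lemma measurableSet_stopped (hD : IsGAMS μ π filt κ D) {q : ℕ} {A : Set Ω}
    (hA : ∀ z, MeasurableSet[D.F q z] A) : MeasurableSet[hD.stopped q] A :=
  ⟨le_iSup (fun z => (D.F q z : MeasurableSpace Ω)) 0 _ (hA 0),
    fun z => (hA z).inter (hD.Z_stopping q z)⟩

lemma priorSigma_le_stopped (hD : IsGAMS μ π filt κ D) (q : ℕ) :
    hD.priorSigma q ≤ hD.stopped q := fun A hA =>
  hD.measurableSet_stopped fun z => by
    rw [hD.F_eq]; exact le_sup_left (a := hD.priorSigma q) A hA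

lemma stopped_mono (hD : IsGAMS μ π filt κ D) : Monotone hD.stopped :=
  monotone_nat_of_le_succ fun q => le_sup_left.trans (hD.priorSigma_le_stopped (q + 1))

lemma measurableSet_I (hD : IsGAMS μ π filt κ D) (q : ℕ) (s : Set (Finset ℕ)) :
    MeasurableSet[hD.stopped q] {ω | D.I q ω ∈ s} :=
  hD.measurableSet_stopped fun z => by
    rw [hD.F_eq]
    exact le_sup_right (b := repSigma (filt z) (D.I q) (D.X q)) _ (measurableSet_label _ _ _ s)

lemma measurableSet_I_eq (hD : IsGAMS μ π filt κ D) (q : ℕ) (J : Finset ℕ) :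
    MeasurableSet[hD.stopped q] {ω | D.I q ω = J} :=
  hD.measurableSet_I q {J}

lemma measurable_Z (hD : IsGAMS μ π filt κ D) (q : ℕ) : Measurable[hD.stopped q] (D.Z q) :=
  (hD.Z_stopping q).measurable

lemma parentSigma_le (hD : IsGAMS μ π filt κ D) (q : ℕ) : D.parentSigma q ≤ mΩ :=
  repSigma_le (fun J => hD.stopped_le _ _ (hD.measurableSet_I_eq (q + 1) J)) (hD.measurable_P q)

lemma history_le (hD : IsGAMS μ π filt κ D) (q : ℕ) : D.history q ≤ mΩ := by
  have hX : ∀ q, repSigma mE (D.I q) (D.X q) ≤ mΩ := fun q =>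
    repSigma_le (fun J => hD.stopped_le _ _ (hD.measurableSet_I_eq q J)) (hD.measurable_X q)
  induction q with
  | zero => exact hX 0
  | succ q ih => exact sup_le (sup_le ih (hD.parentSigma_le q)) (hX _)

lemma repSigma_le_history (D : SplittingData Ω E) (q : ℕ) :
    repSigma mE (D.I q) (D.X q) ≤ D.history q := by
  cases q with
  | zero => exact le_rfl
  | succ q => exact le_sup_right

/-- The fresh random variables are independent of the history; this inclusion makes them independent
of `𝓕 q` as well. -/
lemma stopped_le_history (hD : IsGAMS μ π filt κ D) (q : ℕ) : hD.stopped q ≤ D.history q := by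
  have hX : ∀ q z, repSigma (filt z) (D.I q) (D.X q) ≤ D.history q := fun q z =>
    (repSigma_mono (filt.le z) _ _).trans (repSigma_le_history D q)
  induction q with
  | zero =>
    refine (hD.Z_stopping 0).measurableSpace_le'.trans (iSup_le fun z => ?_)
    rw [hD.F_eq]
    exact sup_le bot_le (hX 0 z)
  | succ q ih =>
    refine (hD.Z_stopping (q + 1)).measurableSpace_le'.trans (iSup_le fun z => ?_)
    rw [hD.F_eq]
    refine sup_le ?_ (hX (q + 1) z)
    exact (sup_le_sup ih le_rfl).trans le_sup_left

lemma priorSigma_le (hD : IsGAMS μ π filt κ D) (q : ℕ) : hD.priorSigma q ≤ mΩ :=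
  (hD.priorSigma_le_stopped q).trans (hD.stopped_le q)

/-- New labels exceed all current ones, so survivors and newcomers can be read off two consecutive
label sets. -/
lemma survivors_eq (hD : IsGAMS μ π filt κ D) (q : ℕ) (ω : Ω) :
    D.survivors q ω = D.I (q + 1) ω ∩ D.I q ω := by
  ext n
  rw [hD.I_succ, Finset.mem_inter, Finset.mem_union]
  constructor
  · exact fun h => ⟨.inl h, Finset.mem_of_mem_filter n h⟩
  · rintro ⟨h | h, h'⟩
    · exact h
    · exact (lt_irrefl _ (D.lt_of_mem_newLabels h h')).elim

lemma newLabels_eq (hD : IsGAMS μ π filt κ D) (q : ℕ) (ω : Ω) :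
    D.newLabels q ω = D.I (q + 1) ω \ D.I q ω := by
  ext n
  rw [hD.I_succ, Finset.mem_sdiff, Finset.mem_union]
  constructor
  · exact fun h => ⟨.inr h, fun h' => lt_irrefl _ (D.lt_of_mem_newLabels h h')⟩
  · rintro ⟨h | h, h'⟩
    · exact (h' (Finset.mem_of_mem_filter n h)).elim
    · exact h

lemma P_mem (hD : IsGAMS μ π filt κ D) {q : ℕ} {ω : Ω} {n : ℕ} (hn : n ∈ D.I (q + 1) ω) :
    D.P q n ω ∈ D.survivors q ω := by
  rw [hD.I_succ, Finset.mem_union] at hn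
  rcases hn with hn | hn
  · rwa [hD.P_old q ω n hn]
  · exact hD.P_new q ω n hn

lemma I_succ_eq_nextLabels (hD : IsGAMS μ π filt κ D) (q : ℕ) (ω : Ω) :
    D.I (q + 1) ω = nextLabels (D.I q ω) fun n => D.B q n ω :=
  hD.I_succ q ω

lemma measurable_X_parent (hD : IsGAMS μ π filt κ D) (q n : ℕ) :
    Measurable fun ω => D.X q (D.P q n ω) ω :=
  measurable_apply_index (hD.measurable_X q) (hD.measurable_P q n)

lemma measurable_Z' (hD : IsGAMS μ π filt κ D) (q : ℕ) : Measurable (D.Z q) :=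
  (hD.measurable_Z q).mono (hD.stopped_le q) le_rfl

/-- The conditional laws of the replicas of iteration `q`, given `priorSigma q`. -/
noncomputable def priorLaw (hD : IsGAMS μ π filt κ D) : ℕ → ℕ → Kernel Ω E
  | 0, _ => Kernel.const Ω π
  | q + 1, n => (resampleKernel κ).comap (fun ω => (D.Z q ω, D.X q (D.P q n ω) ω))
      ((hD.measurable_Z' q).prodMk (hD.measurable_X_parent q n))

/-- Events on which the prior laws are conditional laws at levels at most `z`. -/
def levelSet (D : SplittingData Ω E) : ℕ → ℝ → Set Ω
  | 0, _ => Set.univ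
  | q + 1, z => {ω | D.Z q ω ≤ z}

lemma condIndep_zero [IsProbabilityMeasure μ] (hD : IsGAMS μ π filt κ D) :
    CondIndepWithLaws (hD.priorSigma 0) μ (D.I 0) (D.X 0) (hD.priorLaw 0) := by
  intro A hA J g hg
  rcases MeasurableSpace.measurableSet_bot_iff.1 hA with rfl | rfl
  · simp
  by_cases hJ : Finset.Icc 1 D.N = J
  · subst hJ
    simp only [hD.I_zero, Set.univ_inter, Set.ofPred_true, Measure.restrict_univ, priorLaw,
      Kernel.const_apply, lintegral_const, measure_univ, mul_one]
    have h1 := lintegral_prod_eq_prod_lintegral_of_indepFun Finset.univ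
      (fun (n : Finset.Icc 1 D.N) ω => g n (D.X 0 n ω))
      (hD.X_zero_indep.comp (fun n => g n) fun n => (hg n).1)
      fun n => (hg n).1.comp (hD.measurable_X 0 n)
    have h2 : ∀ ω, ∏ n ∈ Finset.Icc 1 D.N, g n (D.X 0 n ω) =
        ∏ n : Finset.Icc 1 D.N, g n (D.X 0 n ω) := fun ω =>
      (Finset.prod_coe_sort (Finset.Icc 1 D.N) fun n => g n (D.X 0 n ω)).symm
    rw [lintegral_congr h2, h1,
      Finset.prod_coe_sort (Finset.Icc 1 D.N) fun n => ∫⁻ ω, g n (D.X 0 n ω) ∂μ]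
    refine Finset.prod_congr rfl fun n hn => ?_
    rw [← hD.X_zero_law n hn, lintegral_map (hg n).1 (hD.measurable_X 0 n)]
  · simp [hD.I_zero, hJ]

section Stopped

variable [IsProbabilityMeasure μ] [IsProbabilityMeasure π] [IsMarkovKernel κ]

/-- The prior laws are `π`, or resampling laws at the previous level. Consistency makes the kernel
at level `z` conditional under them as soon as `z` is at least that previous level, which
monotonicity of the levels guarantees a.s. when `Z q ≤ z`. -/
lemma setLIntegral_prod_stopped [TopologicalSpace E] [BorelSpace E] [HasOuterApproxClosed E]
    (hright : RightContinuousKernel π κ) (hcons : ConsistentKernel filt π κ)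
    (hD : IsGAMS μ π filt κ D) {q : ℕ}
    (hR : CondIndepWithLaws (hD.priorSigma q) μ (D.I q) (D.X q) (hD.priorLaw q))
    {J T : Finset ℕ} {p : ℕ → ℕ} (hp : ∀ j ∈ T, p j ∈ J) {w : Ω → ℝ≥0∞}
    (hw : Measurable[hD.stopped q] w)
    {g h : ℕ → E → ℝ≥0∞} (hg : ∀ n, BoundedMeasurable (g n)) (hh : ∀ n, BoundedMeasurable (h n)) :
    ∫⁻ ω in {ω | D.I q ω = J}, w ω * ((∏ n ∈ J, g n (D.X q n ω)) *
        ∏ j ∈ T, ∫⁻ y, h j y ∂(resampleKernel κ (D.Z q ω, D.X q (p j) ω))) ∂μ =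
      ∫⁻ ω in {ω | D.I q ω = J}, w ω *
        ((∏ n ∈ J, ∫⁻ y, g n y ∂(resampleKernel κ (D.Z q ω, D.X q n ω))) *
        ∏ j ∈ T, ∫⁻ y, h j y ∂(resampleKernel κ (D.Z q ω, D.X q (p j) ω))) ∂μ := by
  have hJ := hD.stopped_le _ _ (hD.measurableSet_I_eq q J)
  have hpair := fun n => (hD.measurable_Z' q).prodMk (hD.measurable_X q n)
  have hT : Measurable fun ω =>
      ∏ j ∈ T, ∫⁻ y, h j y ∂(resampleKernel κ (D.Z q ω, D.X q (p j) ω)) :=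
    (BoundedMeasurable.prod T fun j => ((hh j).kernel _).comp (hpair (p j))).1
  refine lintegral_mul_eq_of_setLIntegral_eq (hD.stopped_le q)
    ((BoundedMeasurable.prod J fun n => (hg n).comp (hD.measurable_X q n)).1.mul hT)
    ((BoundedMeasurable.prod J fun n => ((hg n).kernel _).comp (hpair n)).1.mul hT) hw
    fun A hA => ?_
  rw [Measure.restrict_restrict (hD.stopped_le q _ hA)]
  refine hR.setLIntegral_prod_stopped (hD.priorSigma_le q) (hD.measurable_X q) hright (hD.F_eq q)
    (hD.Z_stopping q) (C := levelSet D q) (fun z => ?_) (fun z => ?_) (fun z => ?_) hA hJ hp hg hh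
  · cases q with
    | zero => exact .univ
    | succ q => exact le_sup_left (b := D.parentSigma q) _ ((hD.Z_stopping q).measurableSet_le' z)
  · cases q with
    | zero => exact ae_of_all _ fun ω _ n => hcons.of_bot.isConditionalKernel (Set.mem_univ z)
    | succ q =>
      refine ae_of_all _ fun ω hω n => ?_
      have hω : D.Z q ω ≤ z := hω
      obtain ⟨z₀, hz₀⟩ := WithTop.ne_top_iff_exists.1 (ne_top_of_le_ne_top WithTop.coe_ne_top hω)
      rw [← hz₀, WithTop.coe_le_coe] at hω
      rw [priorLaw, Kernel.comap_apply, ← hz₀, resampleKernel_coe]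
      exact (hcons.of_level z₀ _).isConditionalKernel hω
  · cases q with
    | zero => exact ae_of_all _ fun ω _ => Set.mem_univ ω
    | succ q =>
      filter_upwards [hD.Z_mono q] with ω hω h
      exact hω.trans h

end Stopped

end IsGAMS

/-! ### Branching and resampling: the induction on conditional independence -/

/-- The σ-field generated by all the variables introduced before the resampling step leading to
iteration `q + 1`. -/
abbrev SplittingData.parentHistory {Ω E : Type*} [MeasurableSpace Ω] [MeasurableSpace E]
    (D : SplittingData Ω E) (q : ℕ) : MeasurableSpace Ω :=
  D.history q ⊔ D.parentSigma q

lemma measurableSet_parent {Ω E : Type*} [MeasurableSpace Ω] (D : SplittingData Ω E) (q : ℕ) (J : Finset ℕ)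
    (p : ℕ → ℕ) :
    MeasurableSet[D.parentSigma q] {ω | D.I (q + 1) ω = J ∧ ∀ n ∈ J, D.P q n ω = p n} := by
  have h : {ω | D.I (q + 1) ω = J ∧ ∀ n ∈ J, D.P q n ω = p n} =
      {ω | D.I (q + 1) ω ∈ ({J} : Set (Finset ℕ))} ∩
        ⋂ n ∈ J, restrictLabels 0 (D.I (q + 1)) (D.P q) n ⁻¹' {p n} := by
    ext ω
    simp only [Set.mem_ofPred_eq, Set.mem_singleton_iff, Set.mem_inter_iff, Set.mem_iInter,
      Set.mem_preimage]
    refine and_congr_right fun hω => forall₂_congr fun n hn => ?_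
    rw [restrictLabels_of_mem (by rwa [hω])]
  rw [h]
  refine (measurableSet_label _ _ _ _).inter (Finset.measurableSet_biInter _ fun n _ => ?_)
  exact measurable_restrictLabels ⊤ 0 _ _ n trivial

namespace IsGAMS

variable {Ω E : Type*} [mΩ : MeasurableSpace Ω] [mE : MeasurableSpace E] {μ : Measure Ω}
  {π : Measure E} {filt : Filtration ℝ mE} {κ : Kernel (ℝ × E) E} {D : SplittingData Ω E}

lemma measurable_restrict_X (D : SplittingData Ω E) (e : E) (q n : ℕ) :
    Measurable[D.history q] (restrictLabels e (D.I q) (D.X q) n) :=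
  (measurable_restrictLabels mE e _ _ n).mono (repSigma_le_history D q) le_rfl

/-- Integrating out the fresh randomness of the resampling step. -/
lemma setLIntegral_prod_new [IsProbabilityMeasure μ] [IsProbabilityMeasure π] [IsMarkovKernel κ]
    (hD : IsGAMS μ π filt κ D) (q : ℕ) {S : Set Ω}
    (hS : MeasurableSet[D.parentHistory q] S) {J T : Finset ℕ} {p : ℕ → ℕ}
    (hJ : ∀ ω ∈ S, J ⊆ D.I q ω) (hT : ∀ ω ∈ S, ∀ j ∈ T, j ∈ D.newLabels q ω ∧ D.P q j ω = p j)
    {g : ℕ → E → ℝ≥0∞} (hg : ∀ n, BoundedMeasurable (g n)) :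
    ∫⁻ ω in S, (∏ n ∈ J, g n (D.X q n ω)) * ∏ j ∈ T, g j (D.X (q + 1) j ω) ∂μ =
      ∫⁻ ω in S, (∏ n ∈ J, g n (D.X q n ω)) *
        ∏ j ∈ T, ∫⁻ y, g j y ∂(resampleKernel κ (D.Z q ω, D.X q (p j) ω)) ∂μ := by
  obtain ⟨e⟩ := nonempty_of_isProbabilityMeasure π
  obtain ⟨U, f, hU, hUi, hUind, hf, hlaw, hnew⟩ := hD.X_new q
  have hH : D.parentHistory q ≤ mΩ := sup_le (hD.history_le q) (hD.parentSigma_le q)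
  have hSm : MeasurableSet S := hH _ hS
  have hX : ∀ n, Measurable[D.parentHistory q] (restrictLabels e (D.I q) (D.X q) n) := fun n =>
    (measurable_restrict_X D e q n).mono le_sup_left le_rfl
  have hZ : Measurable[D.parentHistory q] (D.Z q) :=
    (hD.measurable_Z q).mono ((hD.stopped_le_history q).trans le_sup_left) le_rfl
  set w : Ω → ℝ≥0∞ :=
    S.indicator fun ω => ∏ n ∈ J, g n (restrictLabels e (D.I q) (D.X q) n ω)
  have hw : Measurable[D.parentHistory q] w :=
    (Finset.measurable_fun_prod _ fun n _ => (hg n).1.comp (hX n)).indicator hS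
  -- `V` gathers everything known before resampling, with absent replicas set to `e` to be
  -- measurable for the past; it is independent of the fresh variables `U'`.
  set V : Ω → ℝ≥0∞ × WithTop ℝ × (ℕ → E) := fun ω =>
    (w ω, D.Z q ω, fun j => restrictLabels e (D.I q) (D.X q) (p j) ω)
  have hV : Measurable[D.parentHistory q] V := hw.prodMk (hZ.prodMk
    ((@measurable_pi_iff Ω ℕ _ (D.parentHistory q) _ _).2 fun j => hX (p j)))
  have hVm : Measurable V := hV.mono hH le_rfl
  set U' : Ω → ℕ → ℝ := fun ω n => U n ω
  have hU' : Measurable U' := measurable_pi_iff.2 hU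
  have hind : IndepFun V U' μ := by
    rw [IndepFun_iff_Indep]
    have h := (indep_of_indep_of_le_right hUind hV.comap_le).symm
    have hc : MeasurableSpace.comap U' MeasurableSpace.pi =
        ⨆ n, MeasurableSpace.comap (U n) inferInstance := by
      simp only [MeasurableSpace.pi, MeasurableSpace.comap_iSup, MeasurableSpace.comap_comp]
      rfl
    rw [hc]
    exact h
  set h : (ℝ≥0∞ × WithTop ℝ × (ℕ → E)) × (ℕ → ℝ) → ℝ≥0∞ := fun x =>
    x.1.1 * ∏ j ∈ T, g j (f j ((x.1.2.1, x.1.2.2 j), x.2 j))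
  have hgf : ∀ j, Measurable fun x => g j (f j x) := fun j => (hg j).1.comp (hf j)
  have hh : Measurable h := by
    refine Measurable.mul (by fun_prop) (Finset.measurable_fun_prod _ fun j _ => ?_)
    exact (hgf j).comp (by fun_prop)
  have hwS : ∀ ω ∈ S, w ω = ∏ n ∈ J, g n (D.X q n ω) := fun ω hω => by
    simp only [w, Set.indicator_of_mem hω]
    exact Finset.prod_congr rfl fun n hn => by rw [restrictLabels_of_mem (hJ ω hω hn)]
  have hpS : ∀ ω ∈ S, ∀ j ∈ T, restrictLabels e (D.I q) (D.X q) (p j) ω = D.X q (p j) ω :=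
    fun ω hω j hj => by
      have hmem := hD.P_new q ω j (hT ω hω j hj).1
      rw [(hT ω hω j hj).2] at hmem
      exact restrictLabels_of_mem (Finset.mem_of_mem_filter _ hmem)
  calc _ = ∫⁻ ω, h (V ω, U' ω) ∂μ := by
        rw [← lintegral_indicator hSm]
        refine lintegral_congr_ae ?_
        filter_upwards [hnew] with ω hω
        by_cases hωS : ω ∈ S
        · rw [Set.indicator_of_mem hωS]
          simp only [h, V, U']
          rw [hwS ω hωS]
          congr 1
          refine Finset.prod_congr rfl fun j hj => ?_
          rw [hω j (hT ω hωS j hj).1, (hT ω hωS j hj).2, hpS ω hωS j hj]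
        · simp [h, V, w, hωS]
    _ = ∫⁻ ω, ∫⁻ u, h (V ω, u) ∂(μ.map U') ∂μ := lintegral_comp_of_indepFun hVm hU' hind hh
    _ = _ := by
        rw [← lintegral_indicator hSm]
        refine lintegral_congr_ae ?_
        filter_upwards [hlaw] with ω hω
        by_cases hωS : ω ∈ S
        · rw [Set.indicator_of_mem hωS, lintegral_map (f := fun u => h (V ω, u))
            (hh.comp measurable_prodMk_left) hU']
          simp only [h, V, U']
          have hm : ∀ j, Measurable fun u : ℝ => g j (f j
              ((D.Z q ω, restrictLabels e (D.I q) (D.X q) (p j) ω), u)) := fun j =>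
            (hgf j).comp measurable_prodMk_left
          have hmU : ∀ j, Measurable fun ω' => g j (f j
              ((D.Z q ω, restrictLabels e (D.I q) (D.X q) (p j) ω), U j ω')) := fun j =>
            (hm j).comp (hU j)
          -- With `V` frozen, the `U j` are independent, so the mean of the product splits into
          -- integrals against the resampling laws.
          rw [lintegral_const_mul _ (Finset.measurable_fun_prod _ fun j _ => hmU j),
            lintegral_prod_eq_prod_lintegral_of_indepFun T
              (fun j ω' => g j (f j
                ((D.Z q ω, restrictLabels e (D.I q) (D.X q) (p j) ω), U j ω')))
              (hUi.comp _ hm) hmU, hwS ω hωS]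
          congr 1
          refine Finset.prod_congr rfl fun j hj => ?_
          have := hω j (hT ω hωS j hj).1
          rw [(hT ω hωS j hj).2] at this
          rw [resampleKernel_apply, ← this, hpS ω hωS j hj, lintegral_map (hg j).1]
          exact (hf j).comp (measurable_prodMk_left.comp (hU j))
        · simp [h, V, w, hωS]

/-- Conditioning on `𝓕 q` the outcome of the branching step. -/
lemma exists_measurable_setLIntegral_branching [IsProbabilityMeasure μ]
    (hD : IsGAMS μ π filt κ D) (q : ℕ) (J₀ J : Finset ℕ) (p : ℕ → ℕ) :
    ∃ d : Ω → ℝ≥0∞, Measurable[hD.stopped q] d ∧ ∀ W : Ω → ℝ≥0∞, Measurable[D.history q] W →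
      ∫⁻ ω in {ω | D.I q ω = J₀} ∩ {ω | D.I (q + 1) ω = J ∧ ∀ n ∈ J, D.P q n ω = p n}, W ω ∂μ =
        ∫⁻ ω in {ω | D.I q ω = J₀}, d ω * W ω ∂μ := by
  obtain ⟨U, b, p', hU, hind, hb, hp', hB, hP⟩ := hD.branching_sampled q
  -- The prescribed outcome as a condition on `(ω, u)`; on `{I q = J₀}` it depends on `ω` through `𝓕
  -- q` only, so its conditional probability given the history is `𝓕 q`-measurable.
  set R : Set (Ω × ℝ) :=
    {x | nextLabels J₀ (fun n => b n x) = J} ∩ ⋂ n ∈ J, p' n ⁻¹' {p n}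
  have hR : MeasurableSet[(hD.stopped q).prod inferInstance] R :=
    (@measurableSet_nextLabels_eq _ ((hD.stopped q).prod inferInstance) J₀ J b hb).inter
      (Finset.measurableSet_biInter _ fun n _ => hp' n (measurableSet_singleton _))
  have hψ : Measurable[(hD.stopped q).prod inferInstance] (R.indicator fun _ => (1 : ℝ≥0∞)) :=
    measurable_const.indicator hR
  obtain ⟨d, hd, hdW⟩ := exists_measurable_lintegral_mul_eq (hD.stopped_le_history q)
    (hD.history_le q) hU hind hψ
  have hJ₀ := hD.measurableSet_I_eq q J₀
  have hJ₀m := hD.stopped_le q _ hJ₀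
  refine ⟨d, hd, fun W hW => ?_⟩
  have hWi := hW.indicator (hD.stopped_le_history q _ hJ₀)
  have hEm := hD.parentSigma_le q _ (measurableSet_parent D q J p)
  rw [← lintegral_indicator (hJ₀m.inter hEm), ← lintegral_indicator hJ₀m]
  trans ∫⁻ ω, d ω * ({ω | D.I q ω = J₀}.indicator W) ω ∂μ
  · rw [← hdW _ hWi]
    refine lintegral_congr_ae ?_
    filter_upwards [hB, hP] with ω hBω hPω
    by_cases h0 : D.I q ω = J₀
    · have hI : D.I (q + 1) ω = nextLabels J₀ fun n => b n (ω, U ω) := by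
        rw [hD.I_succ_eq_nextLabels, h0]
        exact nextLabels_congr fun n hn => hBω n (by rwa [h0])
      have hiff : ω ∈ {ω | D.I (q + 1) ω = J ∧ ∀ n ∈ J, D.P q n ω = p n} ↔ (ω, U ω) ∈ R := by
        simp only [R, Set.mem_ofPred_eq, Set.mem_inter_iff, Set.mem_iInter, Set.mem_preimage,
          Set.mem_singleton_iff, ← hI]
        refine and_congr_right fun hω => forall₂_congr fun n hn => ?_
        rw [hPω n (by rwa [hω])]
      rw [Set.indicator_of_mem (s := {ω | D.I q ω = J₀}) (by exact h0)]
      by_cases hω : (ω, U ω) ∈ R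
      · rw [Set.indicator_of_mem (Set.mem_inter (by exact h0) (hiff.2 hω)), Set.indicator_of_mem hω, one_mul]
      · rw [Set.indicator_of_notMem fun h => hω (hiff.1 h.2), Set.indicator_of_notMem hω, zero_mul]
    · rw [Set.indicator_of_notMem fun h => h0 h.1,
        Set.indicator_of_notMem (s := {ω | D.I q ω = J₀}) (by exact h0), mul_zero]
  · refine lintegral_congr fun ω => ?_
    by_cases h0 : ω ∈ {ω | D.I q ω = J₀} <;> simp only [h0, Set.indicator_of_mem,
      Set.indicator_of_notMem, not_false_eq_true, mul_zero]

section Step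

variable [TopologicalSpace E] [BorelSpace E] [HasOuterApproxClosed E]
  [IsProbabilityMeasure μ] [IsProbabilityMeasure π] [IsMarkovKernel κ]

/-- On a fixed branching outcome, new replicas are integrated out into factors `π_Z` at their
parents, and the outcome itself is exchanged for an `𝓕 q`-measurable weight. Conditional
independence at the stopping level then turns each survivor's `g n (X n)` into `π_Z(g n)(X n)`. This
is the prior law required of it, a survivor being its own parent. -/
lemma setLIntegral_prod_branching (hright : RightContinuousKernel π κ)
    (hcons : ConsistentKernel filt π κ) (hD : IsGAMS μ π filt κ D) {q : ℕ}
    (hR : CondIndepWithLaws (hD.priorSigma q) μ (D.I q) (D.X q) (hD.priorLaw q))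
    {A : Set Ω} (hA : MeasurableSet[hD.stopped q] A) (J₀ J : Finset ℕ) (p : ℕ → ℕ)
    {g : ℕ → E → ℝ≥0∞} (hg : ∀ n, BoundedMeasurable (g n)) :
    ∫⁻ ω in A ∩ ({ω | D.I q ω = J₀} ∩ {ω | D.I (q + 1) ω = J ∧ ∀ n ∈ J, D.P q n ω = p n}),
        ∏ n ∈ J, g n (D.X (q + 1) n ω) ∂μ =
      ∫⁻ ω in A ∩ ({ω | D.I q ω = J₀} ∩ {ω | D.I (q + 1) ω = J ∧ ∀ n ∈ J, D.P q n ω = p n}),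
        ∏ n ∈ J, ∫⁻ y, g n y ∂(hD.priorLaw (q + 1) n ω) ∂μ := by
  obtain ⟨e⟩ := nonempty_of_isProbabilityMeasure π
  set S := A ∩ ({ω | D.I q ω = J₀} ∩ {ω | D.I (q + 1) ω = J ∧ ∀ n ∈ J, D.P q n ω = p n}) with hSdef
  have hJ₀ := hD.measurableSet_I_eq q J₀
  have hE := measurableSet_parent D q J p
  have hSH : MeasurableSet[D.parentHistory q] S :=
    (le_sup_left (b := D.parentSigma q) _ (hD.stopped_le_history q _ hA)).inter
      ((le_sup_left (b := D.parentSigma q) _ (hD.stopped_le_history q _ hJ₀)).inter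
        (le_sup_right (a := D.history q) _ hE))
  have hSm : MeasurableSet S := sup_le (hD.history_le q) (hD.parentSigma_le q) _ hSH
  -- A single point of `S` is enough to read the constraints on `p`: identity on survivors, values
  -- in `J₀` on new labels.
  rcases S.eq_empty_or_nonempty with hS0 | ⟨ω₀, hω₀⟩
  · simp [hS0]
  have hsurv : ∀ ω ∈ S, D.survivors q ω = J ∩ J₀ := fun ω hω => by
    rw [hD.survivors_eq, hω.2.1, hω.2.2.1]
  have hnew : ∀ ω ∈ S, D.newLabels q ω = J \ J₀ := fun ω hω => by
    rw [hD.newLabels_eq, hω.2.1, hω.2.2.1]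
  have hpo : ∀ n ∈ J ∩ J₀, p n = n := fun n hn => by
    rw [← hω₀.2.2.2 n (Finset.mem_of_mem_inter_left hn)]
    exact hD.P_old q ω₀ n (by rwa [hsurv _ hω₀])
  have hpn : ∀ n ∈ J \ J₀, p n ∈ J₀ := fun n hn => by
    rw [← hω₀.2.2.2 n (Finset.mem_sdiff.1 hn).1]
    have := hD.P_new q ω₀ n (by rwa [hnew _ hω₀])
    rw [hsurv _ hω₀] at this
    exact Finset.mem_of_mem_inter_right this
  have hsplit : ∀ u : ℕ → ℝ≥0∞, ∏ n ∈ J, u n = (∏ n ∈ J ∩ J₀, u n) * ∏ n ∈ J \ J₀, u n :=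
    fun u => (Finset.prod_inter_mul_prod_sdiff J J₀ u).symm
  set RK : ℕ → ℕ → Ω → ℝ≥0∞ := fun n m ω =>
    ∫⁻ y, g n y ∂(resampleKernel κ (D.Z q ω, D.X q m ω))
  have hL : ∫⁻ ω in S, ∏ n ∈ J, g n (D.X (q + 1) n ω) ∂μ = ∫⁻ ω in S,
      (∏ n ∈ J ∩ J₀, g n (D.X q n ω)) * ∏ n ∈ J \ J₀, RK n (p n) ω ∂μ := by
    rw [← hD.setLIntegral_prod_new q hSH (fun ω hω => ?_) (fun ω hω j hj => ?_) hg]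
    · refine setLIntegral_congr_fun hSm fun ω hω => ?_
      simp only [hsplit]
      congr 1
      refine Finset.prod_congr rfl fun n hn => ?_
      rw [hD.X_old q ω n (by rwa [hsurv ω hω])]
    · rw [hω.2.1]
      exact Finset.inter_subset_right
    · exact ⟨by rwa [hnew ω hω], hω.2.2.2 j (Finset.mem_sdiff.1 hj).1⟩
  have hRr : ∫⁻ ω in S, ∏ n ∈ J, ∫⁻ y, g n y ∂(hD.priorLaw (q + 1) n ω) ∂μ = ∫⁻ ω in S,
      (∏ n ∈ J ∩ J₀, RK n n ω) * ∏ n ∈ J \ J₀, RK n (p n) ω ∂μ := by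
    refine setLIntegral_congr_fun hSm fun ω hω => ?_
    simp only [hsplit, priorLaw, Kernel.comap_apply, RK]
    congr 1
    · refine Finset.prod_congr rfl fun n hn => ?_
      rw [hω.2.2.2 n (Finset.mem_of_mem_inter_left hn), hpo n hn]
    · refine Finset.prod_congr rfl fun n hn => ?_
      rw [hω.2.2.2 n (Finset.mem_sdiff.1 hn).1]
  rw [hL, hRr]
  set X' := restrictLabels e (D.I q) (D.X q)
  have hX' : ∀ n, Measurable[D.history q] (X' n) := measurable_restrict_X D e q
  have hZ' : Measurable[D.history q] (D.Z q) :=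
    (hD.measurable_Z q).mono (hD.stopped_le_history q) le_rfl
  set RK' : ℕ → ℕ → Ω → ℝ≥0∞ := fun n m ω =>
    ∫⁻ y, g n y ∂(resampleKernel κ (D.Z q ω, X' m ω))
  have hRK' : ∀ n m, Measurable[D.history q] (RK' n m) := fun n m =>
    ((hg n).kernel (resampleKernel κ)).1.comp (hZ'.prodMk (hX' m))
  have hXX : ∀ ω, D.I q ω = J₀ → ∀ n ∈ J₀, X' n ω = D.X q n ω := fun ω hω n hn =>
    restrictLabels_of_mem (by rwa [hω])
  have hRK : ∀ ω, D.I q ω = J₀ → ∀ n, ∀ m ∈ J₀, RK n m ω = RK' n m ω := fun ω hω n m hm => by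
    simp only [RK, RK', hXX ω hω m hm]
  obtain ⟨d, hd, hdW⟩ := hD.exists_measurable_setLIntegral_branching q J₀ J p
  have hJ₀m := hD.stopped_le q _ hJ₀
  have hEm := hD.parentSigma_le q _ hE
  have hfreeze : ∀ W W' : Ω → ℝ≥0∞, Measurable[D.history q] W' →
      (∀ ω, D.I q ω = J₀ → W ω = W' ω) → ∫⁻ ω in S, W ω ∂μ =
        ∫⁻ ω in {ω | D.I q ω = J₀}, A.indicator d ω * W ω ∂μ := fun W W' hW' hWW' => by
    have h1 : ∫⁻ ω in S, W ω ∂μ = ∫⁻ ω in {ω | D.I q ω = J₀} ∩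
        {ω | D.I (q + 1) ω = J ∧ ∀ n ∈ J, D.P q n ω = p n}, A.indicator W' ω ∂μ := by
      rw [setLIntegral_indicator (hD.stopped_le q _ hA)]
      exact setLIntegral_congr_fun hSm fun ω hω => hWW' ω hω.2.1
    rw [h1, hdW _ (hW'.indicator (hD.stopped_le_history q _ hA))]
    refine setLIntegral_congr_fun hJ₀m fun ω hω => ?_
    by_cases hωA : ω ∈ A <;> simp [hωA, hWW' ω hω]
  rw [hfreeze _ (fun ω => (∏ n ∈ J ∩ J₀, g n (X' n ω)) * ∏ n ∈ J \ J₀, RK' n (p n) ω)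
      ((Finset.measurable_fun_prod _ fun n _ => (hg n).1.comp (hX' n)).mul
        (Finset.measurable_fun_prod _ fun n _ => hRK' n (p n))) fun ω hω => ?_,
    hfreeze _ (fun ω => (∏ n ∈ J ∩ J₀, RK' n n ω) * ∏ n ∈ J \ J₀, RK' n (p n) ω)
      ((Finset.measurable_fun_prod _ fun n _ => hRK' n n).mul
        (Finset.measurable_fun_prod _ fun n _ => hRK' n (p n))) fun ω hω => ?_]
  · classical
    -- Killed labels, those of `J₀` outside `J`, receive the test function `1`.
    have key := hD.setLIntegral_prod_stopped hright hcons hR hpn (hd.indicator hA)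
      (g := fun n => if n ∈ J then g n else fun _ => 1) (h := g)
      (fun n => by split_ifs; exacts [hg n, .one]) hg
    have e1 : ∀ ω, ∏ n ∈ J₀, (if n ∈ J then g n else fun _ => 1) (D.X q n ω) =
        ∏ n ∈ J ∩ J₀, g n (D.X q n ω) := fun ω => by
      rw [Finset.inter_comm, ← Finset.filter_mem_eq_inter, Finset.prod_filter]
      exact Finset.prod_congr rfl fun n _ => by split_ifs <;> rfl
    have e2 : ∀ ω, ∏ n ∈ J₀, ∫⁻ y, (if n ∈ J then g n else fun _ => 1) y
        ∂(resampleKernel κ (D.Z q ω, D.X q n ω)) = ∏ n ∈ J ∩ J₀, RK n n ω := fun ω => by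
      rw [Finset.inter_comm, ← Finset.filter_mem_eq_inter, Finset.prod_filter]
      exact Finset.prod_congr rfl fun n _ => by split_ifs <;> simp [RK]
    simp only [e1, e2] at key
    exact key
  · congr 1
    · exact Finset.prod_congr rfl fun n hn => hRK ω hω n n (Finset.mem_of_mem_inter_right hn)
    · exact Finset.prod_congr rfl fun n hn => hRK ω hω n _ (hpn n hn)
  · congr 1
    · exact Finset.prod_congr rfl fun n hn => by rw [hXX ω hω n (Finset.mem_of_mem_inter_right hn)]
    · exact Finset.prod_congr rfl fun n hn => hRK ω hω n _ (hpn n hn)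

lemma condIndep_succ (hright : RightContinuousKernel π κ)
    (hcons : ConsistentKernel filt π κ) (hD : IsGAMS μ π filt κ D) {q : ℕ}
    (hR : CondIndepWithLaws (hD.priorSigma q) μ (D.I q) (D.X q) (hD.priorLaw q)) :
    CondIndepWithLaws (hD.priorSigma (q + 1)) μ (D.I (q + 1)) (D.X (q + 1))
      (hD.priorLaw (q + 1)) := by
  classical
  intro A hA J g hg
  have hI := hD.stopped_le _ _ (hD.measurableSet_I_eq (q + 1) J)
  have hAm := hD.priorSigma_le (q + 1) _ hA
  refine setLIntegral_eq_of_forall_fiber (Y := fun ω => (D.I q ω, fun n : J => D.P q n ω))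
    (fun y => ?_) (hAm.inter hI) ?_
  · have h1 : {ω | (D.I q ω, fun n : J => D.P q n ω) = y} =
        {ω | D.I q ω = y.1} ∩ (fun ω (n : J) => D.P q n ω) ⁻¹' {y.2} := by
      ext ω; exact Prod.ext_iff
    rw [h1]
    have h2 : Measurable fun ω (n : J) => D.P q n ω := measurable_pi_iff.2 fun n =>
      hD.measurable_P q n
    exact (hD.stopped_le _ _ (hD.measurableSet_I_eq q y.1)).inter (h2 (measurableSet_singleton _))
  · rintro ⟨J₀, p₀⟩
    set p : ℕ → ℕ := fun n => if h : n ∈ J then p₀ ⟨n, h⟩ else 0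
    set S := {ω | D.I q ω = J₀} ∩ {ω | D.I (q + 1) ω = J ∧ ∀ n ∈ J, D.P q n ω = p n}
    have hfun : ∀ ω, (fun n : J => D.P q n ω) = p₀ ↔ ∀ n ∈ J, D.P q n ω = p n := fun ω => by
      rw [funext_iff]
      constructor
      · intro h n hn
        simpa [p, hn] using h ⟨n, hn⟩
      · rintro h ⟨n, hn⟩
        simpa [p, hn] using h n hn
    have hset : (A ∩ {ω | D.I (q + 1) ω = J}) ∩
        {ω | (D.I q ω, fun n : J => D.P q n ω) = (J₀, p₀)} = A ∩ S := by
      ext ω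
      simp only [S, Set.mem_inter_iff, Set.mem_ofPred_eq, Prod.mk.injEq, hfun]
      tauto
    -- On `S` the parent map is constant and adds no information to `𝓕 q`.
    have htr : (hD.priorSigma (q + 1)).comap (Subtype.val : S → Ω) ≤
        (hD.stopped q).comap Subtype.val := by
      rw [priorSigma, MeasurableSpace.comap_sup]
      refine sup_le le_rfl ((comap_repSigma_le ⊤ (J := J) fun ω hω => hω.2.1).trans ?_)
      rw [MeasurableSpace.comap_comp]
      have hconst : (fun ω (n : J) => D.P q n ω) ∘ (Subtype.val : S → Ω) = fun _ => p₀ := by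
        funext ω
        exact (hfun ω).2 ω.2.2.2
      rw [hconst, MeasurableSpace.comap_const]
      exact bot_le
    obtain ⟨A', hA', hAA'⟩ := exists_inter_eq_of_comap_le htr hA
    rw [hset, hAA']
    exact hD.setLIntegral_prod_branching hright hcons hR hA' J₀ J p hg

/-- At each iteration, the replicas are conditionally independent before the stopping step. -/
lemma condIndep (hright : RightContinuousKernel π κ)
    (hcons : ConsistentKernel filt π κ) (hD : IsGAMS μ π filt κ D) (q : ℕ) :
    CondIndepWithLaws (hD.priorSigma q) μ (D.I q) (D.X q) (hD.priorLaw q) := by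
  induction q with
  | zero => exact hD.condIndep_zero
  | succ q ih => exact hD.condIndep_succ hright hcons ih

end Step

end IsGAMS

/-! ### Sums over random label sets and the stopped estimator -/

lemma measurable_sum_labels {Ω : Type*} [MeasurableSpace Ω] {I : Ω → Finset ℕ}
    (hI : ∀ J, MeasurableSet {ω | I ω = J}) {f : ℕ → Ω → ℝ≥0∞} (hf : ∀ n, Measurable (f n)) :
    Measurable fun ω => ∑ n ∈ I ω, f n ω := by
  let _ : MeasurableSpace (Finset ℕ) := ⊤
  have hI' : Measurable I := measurable_to_countable' fun J => hI J
  exact (measurable_from_prod_countable_right (f := fun x : Finset ℕ × Ω => ∑ n ∈ x.1, f n x.2)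
    fun J => Finset.measurable_fun_sum _ fun n _ => hf n).comp (hI'.prodMk measurable_id)

/-- Comparison of integrals of sums over random label sets. -/
lemma setLIntegral_sum_labels_congr {Ω : Type*} [MeasurableSpace Ω] {μ : Measure Ω}
    {I : Ω → Finset ℕ} (hI : ∀ J, MeasurableSet {ω | I ω = J}) {A : Set Ω} (hA : MeasurableSet A)
    {f g : ℕ → Ω → ℝ≥0∞} (hf : ∀ n, Measurable (f n)) (hg : ∀ n, Measurable (g n))
    (h : ∀ J, ∀ n ∈ J, ∫⁻ ω in A ∩ {ω | I ω = J}, f n ω ∂μ = ∫⁻ ω in A ∩ {ω | I ω = J}, g n ω ∂μ) :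
    ∫⁻ ω in A, ∑ n ∈ I ω, f n ω ∂μ = ∫⁻ ω in A, ∑ n ∈ I ω, g n ω ∂μ := by
  refine setLIntegral_eq_of_forall_fiber hI hA fun J => ?_
  have aux : ∀ u : ℕ → Ω → ℝ≥0∞, (∀ n, Measurable (u n)) →
      ∫⁻ ω in A ∩ {ω | I ω = J}, ∑ n ∈ I ω, u n ω ∂μ =
        ∑ n ∈ J, ∫⁻ ω in A ∩ {ω | I ω = J}, u n ω ∂μ := fun u hu => by
    rw [← lintegral_finsetSum _ fun n _ => hu n]
    refine setLIntegral_congr_fun (hA.inter (hI J)) fun ω hω => ?_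
    have : I ω = J := hω.2
    simp only [this]
  rw [aux f hf, aux g hg]
  exact Finset.sum_congr rfl (h J)

/-- Only one-replica marginals are needed: the test function is `φ` at one label and `1` at the
others. -/
lemma CondIndepWithLaws.setLIntegral_sum {Ω E : Type*} {𝓐 : MeasurableSpace Ω}
    [mΩ : MeasurableSpace Ω] [MeasurableSpace E] {μ : Measure Ω} {I : Ω → Finset ℕ}
    {X : ℕ → Ω → E} {L : ℕ → Kernel Ω E} [∀ n, IsMarkovKernel (L n)]
    (hR : CondIndepWithLaws 𝓐 μ I X L) (h𝓐 : 𝓐 ≤ mΩ) (hI : ∀ J, MeasurableSet {ω | I ω = J})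
    (hX : ∀ n, Measurable (X n)) {A : Set Ω} (hA : MeasurableSet[𝓐] A) {w : ℕ → Ω → ℝ≥0∞}
    (hw : ∀ n, Measurable[𝓐] (w n)) {φ : E → ℝ≥0∞} (hφ : BoundedMeasurable φ) :
    ∫⁻ ω in A, ∑ n ∈ I ω, w n ω * φ (X n ω) ∂μ =
      ∫⁻ ω in A, ∑ n ∈ I ω, w n ω * ∫⁻ y, φ y ∂(L n ω) ∂μ := by
  classical
  have hwm := fun n => (hw n).mono h𝓐 le_rfl
  have hφX : ∀ n, Measurable fun ω => φ (X n ω) := fun n => hφ.1.comp (hX n)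
  have hφL : ∀ n, Measurable fun ω => ∫⁻ y, φ y ∂(L n ω) := fun n => hφ.1.lintegral_kernel
  refine setLIntegral_sum_labels_congr hI (h𝓐 _ hA) (fun n => (hwm n).mul (hφX n))
    (fun n => (hwm n).mul (hφL n)) fun J n hn => ?_
  have hset : ∀ f : Ω → ℝ≥0∞, ∫⁻ ω in A ∩ {ω | I ω = J}, w n ω * f ω ∂μ =
      ∫⁻ ω, A.indicator (w n) ω * f ω ∂(μ.restrict {ω | I ω = J}) := fun f => by
    rw [← Measure.restrict_restrict (h𝓐 _ hA), ← lintegral_indicator (h𝓐 _ hA)]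
    exact lintegral_congr fun ω => by by_cases h : ω ∈ A <;> simp [h]
  rw [hset, hset]
  refine lintegral_mul_eq_of_setLIntegral_eq h𝓐 (hφX n) (hφL n) ((hw n).indicator hA)
    fun B hB => ?_
  rw [Measure.restrict_restrict (h𝓐 _ hB)]
  have key := hR B hB J (fun m => if m = n then φ else fun _ => 1)
    fun m => by split_ifs; exacts [hφ, .one]
  have e1 : ∀ ω, ∏ m ∈ J, (if m = n then φ else fun _ => 1) (X m ω) = φ (X n ω) := fun ω => by
    rw [Finset.prod_eq_single n (fun m _ hm => by simp [hm]) fun h => (h hn).elim]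
    simp
  have e2 : ∀ ω, ∏ m ∈ J, ∫⁻ y, (if m = n then φ else fun _ => 1) y ∂(L m ω) =
      ∫⁻ y, φ y ∂(L n ω) := fun ω => by
    rw [Finset.prod_eq_single n (fun m _ hm => by simp [hm]) fun h => (h hn).elim]
    simp
  simpa only [e1, e2] using key

namespace SplittingData

variable {Ω E : Type*} [MeasurableSpace Ω]

/-- The weighted empirical estimator at iteration `q`, with values in `[0, ∞]`. -/
noncomputable def lestimator (D : SplittingData Ω E) (φ : E → ℝ≥0∞) (q : ℕ) (ω : Ω) : ℝ≥0∞ :=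
  ∑ n ∈ D.I q ω, ENNReal.ofReal (D.G q n ω) * φ (D.X q n ω)

/-- The event that the algorithm is not stopped at the iterations up to `q`. -/
def running (D : SplittingData Ω E) (q : ℕ) : Set Ω := {ω | ∀ j ≤ q, D.S j ω ≠ 0}

lemma mem_running_iff {D : SplittingData Ω E} {ω : Ω} (h : D.Qiter ω < ⊤) (q : ℕ) :
    ω ∈ D.running q ↔ q < (D.Qiter ω).toNat := by
  have hne : {q | D.S q ω = 0}.Nonempty := by
    by_contra hne
    rw [Set.not_nonempty_iff_eq_empty] at hne
    simp [Qiter, hne] at h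
  have hQ : D.Qiter ω = ((sInf {q | D.S q ω = 0} : ℕ) : ℕ∞) := by
    rw [Qiter, sInf_image, ENat.natCast_sInf hne]
  rw [hQ, ENat.toNat_natCast]
  constructor
  · intro hω
    by_contra hle
    exact hω _ (not_lt.1 hle) (Nat.sInf_mem hne)
  · intro hlt j hj h0
    exact absurd (Nat.sInf_le (s := {q | D.S q ω = 0}) h0) (by omega)

lemma stopped_lestimator_succ {D : SplittingData Ω E} {μ : Measure Ω}
    (hfin : ∀ᵐ ω ∂μ, D.Qiter ω < ⊤) (φ : E → ℝ≥0∞) (q : ℕ) :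
    ∀ᵐ ω ∂μ, (ω ∈ D.running q → D.lestimator φ (min (D.Qiter ω).toNat q) ω = D.lestimator φ q ω ∧
      D.lestimator φ (min (D.Qiter ω).toNat (q + 1)) ω = D.lestimator φ (q + 1) ω) ∧
      (ω ∉ D.running q → D.lestimator φ (min (D.Qiter ω).toNat (q + 1)) ω =
        D.lestimator φ (min (D.Qiter ω).toNat q) ω) := by
  filter_upwards [hfin] with ω hω
  rw [D.mem_running_iff hω]
  refine ⟨fun h => ⟨by rw [min_eq_right h.le], by rw [min_eq_right h]⟩, fun h => ?_⟩
  rw [min_eq_left (by omega), min_eq_left (by omega)]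

lemma tendsto_stopped_lestimator (D : SplittingData Ω E) (φ : E → ℝ≥0∞) (ω : Ω) :
    Tendsto (fun q => D.lestimator φ (min (D.Qiter ω).toNat q) ω) atTop
      (𝓝 (D.lestimator φ (D.Qiter ω).toNat ω)) := by
  refine tendsto_const_nhds.congr' ?_
  filter_upwards [eventually_ge_atTop (D.Qiter ω).toNat] with q hq
  rw [min_eq_left hq]

lemma estimator_eq_toReal (D : SplittingData Ω E) {φ : E → ℝ} (hφ : ∀ x, 0 ≤ φ x) {q : ℕ} {ω : Ω}
    (hG : ∀ n ∈ D.I q ω, 0 ≤ D.G q n ω) :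
    D.estimator φ q ω = (D.lestimator (fun x => ENNReal.ofReal (φ x)) q ω).toReal := by
  rw [SplittingData.estimator, SplittingData.lestimator,
    ENNReal.toReal_sum fun n _ => ENNReal.mul_ne_top ENNReal.ofReal_ne_top ENNReal.ofReal_ne_top]
  refine Finset.sum_congr rfl fun n hn => ?_
  rw [ENNReal.toReal_mul, ENNReal.toReal_ofReal (hG n hn), ENNReal.toReal_ofReal (hφ _)]

end SplittingData

/-! ### Weights and measurability of the estimator -/

namespace IsGAMS

variable {Ω E : Type*} [mΩ : MeasurableSpace Ω] [mE : MeasurableSpace E] {μ : Measure Ω}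
  {π : Measure E} {filt : Filtration ℝ mE} {κ : Kernel (ℝ × E) E} {D : SplittingData Ω E}

/-- A survivor is the parent of itself and of `B - 1` new labels; a killed label contributes zero to
both sides. -/
lemma sum_parent (hD : IsGAMS μ π filt κ D) (q : ℕ) (ω : Ω) (f : ℕ → ℝ≥0∞) :
    ∑ n ∈ D.I (q + 1) ω, f (D.P q n ω) = ∑ n ∈ D.I q ω, (D.B q n ω : ℝ≥0∞) * f n := by
  have hdis : Disjoint (D.survivors q ω) (D.newLabels q ω) := by
    rw [hD.survivors_eq, hD.newLabels_eq]
    exact Finset.disjoint_left.2 fun n h h' =>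
      (Finset.mem_sdiff.1 h').2 (Finset.mem_of_mem_inter_right h)
  have h1 : ∑ n ∈ D.newLabels q ω, f (D.P q n ω) =
      ∑ n ∈ D.survivors q ω, ((D.B q n ω - 1 : ℕ) : ℝ≥0∞) * f n := by
    rw [← Finset.sum_fiberwise_of_maps_to (g := fun n => D.P q n ω) (hD.P_new q ω)]
    refine Finset.sum_congr rfl fun n hn => ?_
    rw [← hD.P_card q ω n hn, ← nsmul_eq_mul, ← Finset.sum_const]
    exact Finset.sum_congr rfl fun m hm => by rw [(Finset.mem_filter.1 hm).2]
  rw [hD.I_succ, Finset.sum_union hdis, h1, ← Finset.sum_add_distrib]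
  have h2 : ∑ n ∈ D.I q ω, (D.B q n ω : ℝ≥0∞) * f n =
      ∑ n ∈ D.survivors q ω, (D.B q n ω : ℝ≥0∞) * f n := by
    rw [SplittingData.survivors, Finset.sum_filter]
    refine Finset.sum_congr rfl fun n _ => ?_
    split_ifs with h
    · rfl
    · simp [not_not.1 h]
  rw [h2]
  refine Finset.sum_congr rfl fun n hn => ?_
  rw [hD.P_old q ω n hn]
  have hB : D.B q n ω ≠ 0 := (Finset.mem_filter.1 hn).2
  obtain ⟨k, hk⟩ := Nat.exists_eq_succ_of_ne_zero hB
  rw [hk]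
  push_cast [Nat.succ_eq_add_one, Nat.add_sub_cancel]
  ring

/-- The conditional mean of the branching numbers. -/
noncomputable abbrev meanB (hD : IsGAMS μ π filt κ D) (q n : ℕ) : Ω → ℝ≥0∞ :=
  condLExp (hD.stopped q) μ fun ω' => (D.B q n ω' : ℝ≥0∞)

lemma G_succ_ofReal (hD : IsGAMS μ π filt κ D) (q : ℕ) : ∀ᵐ ω ∂μ, ∀ n' ∈ D.I (q + 1) ω,
    (0 ≤ D.G q (D.P q n' ω) ω → 0 ≤ D.G (q + 1) n' ω) ∧ ENNReal.ofReal (D.G (q + 1) n' ω) =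
      ENNReal.ofReal (D.G q (D.P q n' ω) ω) / hD.meanB q (D.P q n' ω) ω := by
  filter_upwards [hD.G_succ q, hD.branching_mean q] with ω hG hm n' hn'
  have hP := hD.P_mem hn'
  obtain ⟨h0, h1⟩ := hm _ (Finset.mem_of_mem_filter _ hP)
  rw [hG n' hn' _ hP rfl]
  refine ⟨fun h => div_nonneg h ENNReal.toReal_nonneg, ?_⟩
  rw [ENNReal.ofReal_div_of_pos (ENNReal.toReal_pos h0.ne' h1.ne), ENNReal.ofReal_toReal h1.ne]

lemma G_nonneg (hD : IsGAMS μ π filt κ D) (q : ℕ) : ∀ᵐ ω ∂μ, ∀ n ∈ D.I q ω, 0 ≤ D.G q n ω := by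
  induction q with
  | zero => exact ae_of_all _ fun ω n hn => by rw [hD.G_zero ω n hn]; positivity
  | succ q ih =>
    filter_upwards [ih, hD.G_succ_ofReal q] with ω h1 h2 n hn
    exact (h2 n hn).1 (h1 _ (Finset.mem_of_mem_filter _ (hD.P_mem hn)))

/-- The weights have versions measurable with respect to `priorSigma`. -/
lemma exists_weight (hD : IsGAMS μ π filt κ D) (q : ℕ) :
    ∃ γ : ℕ → Ω → ℝ≥0∞, (∀ n, Measurable[hD.priorSigma q] (γ n)) ∧
      ∀ᵐ ω ∂μ, ∀ n ∈ D.I q ω, ENNReal.ofReal (D.G q n ω) = γ n ω := by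
  induction q with
  | zero =>
    exact ⟨fun _ _ => ENNReal.ofReal (1 / D.N), fun n => measurable_const,
      ae_of_all _ fun ω n hn => by rw [hD.G_zero ω n hn]⟩
  | succ q ih =>
    obtain ⟨γ, hγ, hGγ⟩ := ih
    -- The default parent `0` at absent labels is arbitrary; it makes the parent measurable for
    -- `parentSigma`.
    refine ⟨fun n ω => γ (restrictLabels 0 (D.I (q + 1)) (D.P q) n ω) ω /
      hD.meanB q (restrictLabels 0 (D.I (q + 1)) (D.P q) n ω) ω, fun n => ?_, ?_⟩
    · have h1 : Measurable[hD.priorSigma (q + 1)] (restrictLabels 0 (D.I (q + 1)) (D.P q) n) :=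
        (measurable_restrictLabels ⊤ 0 _ _ n).mono le_sup_right le_rfl
      have h2 : ∀ m, Measurable[hD.priorSigma (q + 1)] fun ω => γ m ω / hD.meanB q m ω :=
        fun m => ((hγ m).mono ((hD.priorSigma_le_stopped q).trans le_sup_left) le_rfl).div
          ((measurable_condLExp _ _ _).mono le_sup_left le_rfl)
      exact measurable_apply_index h2 h1
    · filter_upwards [hGγ, hD.G_succ_ofReal q] with ω h1 h2 n hn
      rw [(h2 n hn).2, restrictLabels_of_mem hn,
        h1 _ (Finset.mem_of_mem_filter _ (hD.P_mem hn))]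

lemma measurableSet_I_eq' (hD : IsGAMS μ π filt κ D) (q : ℕ) (J : Finset ℕ) :
    MeasurableSet {ω | D.I q ω = J} :=
  hD.stopped_le _ _ (hD.measurableSet_I_eq q J)

lemma aemeasurable_lestimator (hD : IsGAMS μ π filt κ D) {φ : E → ℝ≥0∞} (hφ : Measurable φ)
    (q : ℕ) : AEMeasurable (D.lestimator φ q) μ := by
  obtain ⟨γ, hγ, hG⟩ := hD.exists_weight q
  refine ⟨fun ω => ∑ n ∈ D.I q ω, γ n ω * φ (D.X q n ω),
    measurable_sum_labels (hD.measurableSet_I_eq' q) fun n =>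
      ((hγ n).mono (hD.priorSigma_le q) le_rfl).mul (hφ.comp (hD.measurable_X q n)), ?_⟩
  filter_upwards [hG] with ω hω
  exact Finset.sum_congr rfl fun n hn => by rw [hω n hn]

lemma measurableSet_running (hD : IsGAMS μ π filt κ D) (q : ℕ) :
    MeasurableSet[hD.stopped q] (D.running q) := by
  have : D.running q = ⋂ j ∈ Finset.range (q + 1), D.S j ⁻¹' {0}ᶜ := by
    ext ω
    simp [SplittingData.running]
  rw [this]
  refine Finset.measurableSet_biInter _ fun j hj => ?_
  exact hD.stopped_mono (Nat.lt_succ_iff.1 (Finset.mem_range.1 hj)) _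
    (hD.S_measurable j (measurableSet_singleton _).compl)

lemma aemeasurable_stopped_lestimator (hD : IsGAMS μ π filt κ D)
    (hfin : ∀ᵐ ω ∂μ, D.Qiter ω < ⊤) {φ : E → ℝ≥0∞} (hφ : Measurable φ) (q : ℕ) :
    AEMeasurable (fun ω => D.lestimator φ (min (D.Qiter ω).toNat q) ω) μ := by
  classical
  induction q with
  | zero => simpa using hD.aemeasurable_lestimator hφ 0
  | succ q ih =>
    have hr := hD.stopped_le q _ (hD.measurableSet_running q)
    refine (AEMeasurable.add ((hD.aemeasurable_lestimator hφ (q + 1)).indicator hr)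
      (ih.indicator hr.compl)).congr ?_
    filter_upwards [SplittingData.stopped_lestimator_succ hfin φ q] with ω hω
    by_cases h : ω ∈ D.running q
    · simp [h, (hω.1 h).2]
    · simp [h, hω.2 h]

lemma aemeasurable_final_lestimator (hD : IsGAMS μ π filt κ D)
    (hfin : ∀ᵐ ω ∂μ, D.Qiter ω < ⊤) {φ : E → ℝ≥0∞} (hφ : Measurable φ) :
    AEMeasurable (fun ω => D.lestimator φ (D.Qiter ω).toNat ω) μ :=
  aemeasurable_of_tendsto_metrizable_ae atTop (hD.aemeasurable_stopped_lestimator hfin hφ)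
    (ae_of_all _ (D.tendsto_stopped_lestimator φ))

/-! ### Martingale identity and unbiasedness -/

section Unbiased

variable [IsProbabilityMeasure μ]

/-- In integrals over `𝓕 q`-measurable events, branching numbers can be replaced by their
conditional means. -/
lemma setLIntegral_B_mul (hD : IsGAMS μ π filt κ D) {q : ℕ} {J : Finset ℕ} {n : ℕ} (hn : n ∈ J)
    {A : Set Ω} (hA : MeasurableSet[hD.stopped q] A) {W : Ω → ℝ≥0∞}
    (hW : Measurable[D.history q] W) :
    ∫⁻ ω in A ∩ {ω | D.I q ω = J}, (D.B q n ω : ℝ≥0∞) * W ω ∂μ =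
      ∫⁻ ω in A ∩ {ω | D.I q ω = J}, hD.meanB q n ω * W ω ∂μ := by
  obtain ⟨U, b, -, hU, hind, hb, -, hB, -⟩ := hD.branching_sampled q
  have hψ : Measurable[(hD.stopped q).prod inferInstance] fun x => (b n x : ℝ≥0∞) :=
    measurable_from_nat.comp (hb n)
  obtain ⟨d, hd, hdW⟩ := exists_measurable_lintegral_mul_eq (hD.stopped_le_history q)
    (hD.history_le q) hU hind hψ
  have hI := hD.measurableSet_I_eq q J
  have hdB : ∀ A, MeasurableSet[hD.stopped q] A → ∀ W, Measurable[D.history q] W →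
      ∫⁻ ω in A ∩ {ω | D.I q ω = J}, (D.B q n ω : ℝ≥0∞) * W ω ∂μ =
        ∫⁻ ω in A ∩ {ω | D.I q ω = J}, d ω * W ω ∂μ := fun A hA W hW => by
    have hAI := hA.inter hI
    have hAIm := hD.stopped_le q _ hAI
    have h1 := hdW _ (hW.indicator (hD.stopped_le_history q _ hAI))
    rw [← lintegral_indicator hAIm, ← lintegral_indicator hAIm]
    convert! h1 using 1
    · refine lintegral_congr_ae ?_
      filter_upwards [hB] with ω hω
      by_cases h : ω ∈ A ∩ {ω | D.I q ω = J}
      · have hωJ : D.I q ω = J := h.2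
        rw [Set.indicator_of_mem h, Set.indicator_of_mem h, hω n (by rwa [hωJ])]
      · rw [Set.indicator_of_notMem h, Set.indicator_of_notMem h, mul_zero]
    · refine lintegral_congr fun ω => ?_
      by_cases h : ω ∈ A ∩ {ω | D.I q ω = J}
      · rw [Set.indicator_of_mem h, Set.indicator_of_mem h]
      · rw [Set.indicator_of_notMem h, Set.indicator_of_notMem h, mul_zero]
  -- Uniqueness of conditional means identifies `d` with `meanB`, on `{I q = J}` only: the sampling
  -- representation of `B` holds just for labels that are present.
  have hcond : ∀ Y : Ω → ℝ≥0∞, Measurable[hD.stopped q] Y →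
      (∀ A, MeasurableSet[hD.stopped q] A → ∫⁻ ω in A ∩ {ω | D.I q ω = J}, Y ω ∂μ =
        ∫⁻ ω in A ∩ {ω | D.I q ω = J}, (D.B q n ω : ℝ≥0∞) ∂μ) →
      {ω | D.I q ω = J}.indicator Y =ᵐ[μ] condLExp (hD.stopped q) μ
        ({ω | D.I q ω = J}.indicator fun ω => (D.B q n ω : ℝ≥0∞)) := fun Y hY h => by
    refine ae_eq_condLExp (hm := hD.stopped_le q) _ _ (hY.indicator hI) fun A hA => ?_
    rw [setLIntegral_indicator (hD.stopped_le q _ hI), setLIntegral_indicator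
      (hD.stopped_le q _ hI), Set.inter_comm, h A hA]
  have hae := (hcond d hd fun A hA => by
      simpa using (hdB A hA (fun _ => 1) measurable_const).symm).trans
    (hcond (hD.meanB q n) (measurable_condLExp _ _ _) fun A hA =>
      setLIntegral_condLExp (hm := hD.stopped_le q) _ _ (hA.inter hI)).symm
  rw [hdB A hA W hW]
  refine setLIntegral_congr_fun_ae (hD.stopped_le q _ (hA.inter hI)) ?_
  filter_upwards [hae] with ω hω hωA
  rw [Set.indicator_of_mem hωA.2, Set.indicator_of_mem hωA.2] at hω
  rw [hω]

variable [IsProbabilityMeasure π] [IsMarkovKernel κ]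

instance (hD : IsGAMS μ π filt κ D) (q n : ℕ) : IsMarkovKernel (hD.priorLaw q n) := by
  cases q <;> simp only [priorLaw] <;> infer_instance

lemma lintegral_lestimator_zero (hD : IsGAMS μ π filt κ D) {φ : E → ℝ≥0∞}
    (hφ : BoundedMeasurable φ) : ∫⁻ ω, D.lestimator φ 0 ω ∂μ = ∫⁻ x, φ x ∂π := by
  have h1 := hD.condIndep_zero.setLIntegral_sum (hD.priorSigma_le 0) (hD.measurableSet_I_eq' 0)
    (hD.measurable_X 0) .univ (w := fun _ _ => ENNReal.ofReal (1 / D.N))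
    (fun n => measurable_const) hφ
  simp only [Measure.restrict_univ, priorLaw, Kernel.const_apply, hD.I_zero, Finset.sum_const,
    lintegral_const, measure_univ, mul_one, Nat.card_Icc, Nat.add_sub_cancel, nsmul_eq_mul] at h1
  have h2 : ∀ ω, D.lestimator φ 0 ω =
      ∑ n ∈ Finset.Icc 1 D.N, ENNReal.ofReal (1 / D.N) * φ (D.X 0 n ω) := fun ω => by
    rw [SplittingData.lestimator, hD.I_zero]
    refine Finset.sum_congr rfl fun n hn => ?_
    rw [hD.G_zero ω n (by rwa [hD.I_zero])]
  have hN : (0 : ℝ) < D.N := by exact_mod_cast hD.N_pos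
  rw [lintegral_congr h2, h1, ← mul_assoc, ← ENNReal.ofReal_natCast, ← ENNReal.ofReal_mul hN.le,
    mul_one_div_cancel hN.ne', ENNReal.ofReal_one, one_mul]

variable [TopologicalSpace E] [BorelSpace E] [HasOuterApproxClosed E]

/-- The conditional laws of the replicas after the stopping step. -/
noncomputable def stoppedLaw (hD : IsGAMS μ π filt κ D) (q n : ℕ) : Kernel Ω E :=
  (resampleKernel κ).comap (fun ω => (D.Z q ω, D.X q n ω))
    ((hD.measurable_Z' q).prodMk (hD.measurable_X q n))

instance (hD : IsGAMS μ π filt κ D) (q n : ℕ) : IsMarkovKernel (hD.stoppedLaw q n) := by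
  rw [stoppedLaw]; infer_instance

/-- At each iteration, the replicas are conditionally independent after the stopping step. -/
lemma condIndep_stopped (hright : RightContinuousKernel π κ)
    (hcons : ConsistentKernel filt π κ) (hD : IsGAMS μ π filt κ D) (q : ℕ) :
    CondIndepWithLaws (hD.stopped q) μ (D.I q) (D.X q) (hD.stoppedLaw q) := by
  intro A hA J g hg
  have key := hD.setLIntegral_prod_stopped hright hcons (hD.condIndep hright hcons q) (J := J)
    (T := ∅) (p := id) (by simp) (measurable_const.indicator hA (f := fun _ => 1)) hg hg
  have hAm := hD.stopped_le q _ hA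
  have aux : ∀ F : Ω → ℝ≥0∞, ∫⁻ ω in A ∩ {ω | D.I q ω = J}, F ω ∂μ =
      ∫⁻ ω in {ω | D.I q ω = J}, A.indicator (fun _ => 1) ω * F ω ∂μ := fun F => by
    rw [← setLIntegral_indicator hAm]
    exact lintegral_congr fun ω => by by_cases h : ω ∈ A <;> simp [h]
  rw [aux, aux]
  simp only [Finset.prod_empty, mul_one] at key
  exact key

/-- Each child is averaged under its prior law, which depends on the parent only; the sum over
children becomes a sum over parents weighted by `B`. Then `B` is exchanged for its conditional mean,
which the weights cancel, and conditional independence after stopping turns `π_Z(φ)(X n)` back into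
`φ (X n)`. -/
lemma setLIntegral_lestimator_succ (hright : RightContinuousKernel π κ)
    (hcons : ConsistentKernel filt π κ) (hD : IsGAMS μ π filt κ D) (q : ℕ) {φ : E → ℝ≥0∞}
    (hφ : BoundedMeasurable φ) {A : Set Ω} (hA : MeasurableSet[hD.stopped q] A) :
    ∫⁻ ω in A, D.lestimator φ (q + 1) ω ∂μ = ∫⁻ ω in A, D.lestimator φ q ω ∂μ := by
  obtain ⟨e⟩ := nonempty_of_isProbabilityMeasure π
  obtain ⟨γ, hγ, hGγ⟩ := hD.exists_weight q
  obtain ⟨γ', hγ', hGγ'⟩ := hD.exists_weight (q + 1)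
  have hγs : ∀ n, Measurable[hD.stopped q] (γ n) := fun n =>
    (hγ n).mono (hD.priorSigma_le_stopped q) le_rfl
  have hAm := hD.stopped_le q _ hA
  set X' := restrictLabels e (D.I q) (D.X q)
  have hX' : ∀ n, Measurable[D.history q] (X' n) := measurable_restrict_X D e q
  have hZ' : Measurable[D.history q] (D.Z q) :=
    (hD.measurable_Z q).mono (hD.stopped_le_history q) le_rfl
  set RK : ℕ → Ω → ℝ≥0∞ := fun n ω => ∫⁻ y, φ y ∂(resampleKernel κ (D.Z q ω, X' n ω))
  have hRK : ∀ n, Measurable[D.history q] (RK n) := fun n =>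
    (hφ.kernel (resampleKernel κ)).1.comp (hZ'.prodMk (hX' n))
  have hV : ∀ n, Measurable[D.history q] fun ω => γ n ω / hD.meanB q n ω * RK n ω := fun n =>
    Measurable.mul ((((hγs n).div (measurable_condLExp _ _ _)).mono (hD.stopped_le_history q)
      le_rfl)) (hRK n)
  have hmean : ∀ n, Measurable (hD.meanB q n) := fun n => measurable_condLExp' _ _ _
  have hBm : ∀ n, Measurable fun ω => (D.B q n ω : ℝ≥0∞) := fun n =>
    measurable_from_nat.comp (hD.measurable_B q n)
  have hVm := fun n => (hV n).mono (hD.history_le q) le_rfl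
  calc ∫⁻ ω in A, D.lestimator φ (q + 1) ω ∂μ
      = ∫⁻ ω in A, ∑ n ∈ D.I (q + 1) ω, γ' n ω * φ (D.X (q + 1) n ω) ∂μ := by
        refine lintegral_congr_ae (ae_restrict_of_ae ?_)
        filter_upwards [hGγ'] with ω hω
        exact Finset.sum_congr rfl fun n hn => by rw [hω n hn]
    _ = ∫⁻ ω in A, ∑ n ∈ D.I (q + 1) ω, γ' n ω * ∫⁻ y, φ y ∂(hD.priorLaw (q + 1) n ω) ∂μ :=
        (hD.condIndep hright hcons (q + 1)).setLIntegral_sum (hD.priorSigma_le (q + 1))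
          (hD.measurableSet_I_eq' (q + 1)) (hD.measurable_X (q + 1))
          (le_sup_left (b := D.parentSigma q) _ hA) hγ' hφ
    _ = ∫⁻ ω in A, ∑ n ∈ D.I q ω, (D.B q n ω : ℝ≥0∞) *
          (γ n ω / hD.meanB q n ω * RK n ω) ∂μ := by
        refine lintegral_congr_ae (ae_restrict_of_ae ?_)
        filter_upwards [hGγ, hGγ', hD.G_succ_ofReal q] with ω h1 h2 h3
        rw [← hD.sum_parent q ω fun n => γ n ω / hD.meanB q n ω * RK n ω]
        refine Finset.sum_congr rfl fun n hn => ?_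
        have hP := Finset.mem_of_mem_filter _ (hD.P_mem hn)
        rw [← h2 n hn, (h3 n hn).2, h1 _ hP]
        simp only [RK, X', restrictLabels_of_mem hP]
        rfl
    _ = ∫⁻ ω in A, ∑ n ∈ D.I q ω, hD.meanB q n ω * (γ n ω / hD.meanB q n ω * RK n ω) ∂μ :=
        setLIntegral_sum_labels_congr (hD.measurableSet_I_eq' q) hAm
          (fun n => (hBm n).mul (hVm n)) (fun n => (hmean n).mul (hVm n)) fun J n hn =>
            hD.setLIntegral_B_mul hn hA (hV n)
    _ = ∫⁻ ω in A, ∑ n ∈ D.I q ω, γ n ω * ∫⁻ y, φ y ∂(hD.stoppedLaw q n ω) ∂μ := by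
        refine lintegral_congr_ae (ae_restrict_of_ae ?_)
        filter_upwards [hD.branching_mean q] with ω h
        refine Finset.sum_congr rfl fun n hn => ?_
        -- Cancellation in `[0, ∞]` is where the mean must be neither zero nor infinite.
        rw [← mul_assoc, ENNReal.mul_div_cancel (h n hn).1.ne' (h n hn).2.ne]
        simp only [RK, X', restrictLabels_of_mem hn]
        rfl
    _ = ∫⁻ ω in A, ∑ n ∈ D.I q ω, γ n ω * φ (D.X q n ω) ∂μ :=
        ((hD.condIndep_stopped hright hcons q).setLIntegral_sum (hD.stopped_le q)
          (hD.measurableSet_I_eq' q) (hD.measurable_X q) hA hγs hφ).symm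
    _ = ∫⁻ ω in A, D.lestimator φ q ω ∂μ := by
        refine lintegral_congr_ae (ae_restrict_of_ae ?_)
        filter_upwards [hGγ] with ω hω
        exact Finset.sum_congr rfl fun n hn => by rw [hω n hn]

/-- Optional stopping: from `q` to `q + 1` the stopped estimator moves only on `running q`, an event
of `𝓕 q`, and there the martingale identity applies. -/
lemma lintegral_stopped_lestimator (hright : RightContinuousKernel π κ)
    (hcons : ConsistentKernel filt π κ) (hD : IsGAMS μ π filt κ D)
    (hfin : ∀ᵐ ω ∂μ, D.Qiter ω < ⊤) {φ : E → ℝ≥0∞} (hφ : BoundedMeasurable φ) (q : ℕ) :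
    ∫⁻ ω, D.lestimator φ (min (D.Qiter ω).toNat q) ω ∂μ = ∫⁻ x, φ x ∂π := by
  induction q with
  | zero => simpa using hD.lintegral_lestimator_zero hφ
  | succ q ih =>
    have hr := hD.stopped_le q _ (hD.measurableSet_running q)
    have hae := SplittingData.stopped_lestimator_succ hfin φ q
    rw [← ih, ← lintegral_add_compl _ hr,
      ← lintegral_add_compl (fun ω => D.lestimator φ (min (D.Qiter ω).toNat q) ω) hr]
    congr 1
    · trans ∫⁻ ω in D.running q, D.lestimator φ (q + 1) ω ∂μ
      · exact setLIntegral_congr_fun_ae hr (hae.mono fun ω h hω => (h.1 hω).2)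
      · rw [hD.setLIntegral_lestimator_succ hright hcons q hφ (hD.measurableSet_running q)]
        exact setLIntegral_congr_fun_ae hr (hae.mono fun ω h hω => (h.1 hω).1.symm)
    · exact setLIntegral_congr_fun_ae hr.compl (hae.mono fun ω h hω => h.2 hω)

lemma lintegral_final_lestimator (hright : RightContinuousKernel π κ)
    (hcons : ConsistentKernel filt π κ) (hD : IsGAMS μ π filt κ D)
    (hfin : ∀ᵐ ω ∂μ, D.Qiter ω < ⊤)
    (hcase : (∃ C : ℕ, ∀ᵐ ω ∂μ, D.Qiter ω ≤ C) ∨ D.MassConserved μ)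
    {φ : E → ℝ≥0∞} (hφ : BoundedMeasurable φ) :
    ∫⁻ ω, D.lestimator φ (D.Qiter ω).toNat ω ∂μ = ∫⁻ x, φ x ∂π := by
  rcases hcase with ⟨C, hC⟩ | hmass
  · rw [← hD.lintegral_stopped_lestimator hright hcons hfin hφ C]
    refine lintegral_congr_ae ?_
    filter_upwards [hC] with ω hω
    rw [min_eq_left]
    simpa using ENat.toNat_le_toNat hω (ENat.natCast_ne_top C)
  · obtain ⟨hφm, c, hc⟩ := id hφ
    have hlim := tendsto_lintegral_of_dominated_convergence' (μ := μ) (fun _ => (c : ℝ≥0∞))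
      (hD.aemeasurable_stopped_lestimator hfin hφm) (fun q => ?_) (by simp)
      (ae_of_all _ (D.tendsto_stopped_lestimator φ))
    · simp only [hD.lintegral_stopped_lestimator hright hcons hfin hφ] at hlim
      exact tendsto_nhds_unique hlim tendsto_const_nhds
    -- Nonnegative weights of total mass one keep every stopped estimator below the bound `c` of
    -- `φ`.
    · filter_upwards [ae_all_iff.2 hmass, ae_all_iff.2 hD.G_nonneg] with ω h1 h2
      set k := min (D.Qiter ω).toNat q
      calc D.lestimator φ k ω ≤ ∑ n ∈ D.I k ω, ENNReal.ofReal (D.G k n ω) * c :=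
            Finset.sum_le_sum fun n _ => mul_le_mul_right (hc _) _
        _ = c := by
            rw [← Finset.sum_mul, ← ENNReal.ofReal_sum_of_nonneg (h2 k), h1 k,
              ENNReal.ofReal_one, one_mul]

lemma integral_estimator_of_nonneg (hright : RightContinuousKernel π κ)
    (hcons : ConsistentKernel filt π κ) (hD : IsGAMS μ π filt κ D)
    (hfin : ∀ᵐ ω ∂μ, D.Qiter ω < ⊤)
    (hcase : (∃ C : ℕ, ∀ᵐ ω ∂μ, D.Qiter ω ≤ C) ∨ D.MassConserved μ)
    {φ : E → ℝ} (hφ : Measurable φ) (hφ0 : ∀ x, 0 ≤ φ x) {C : ℝ} (hφC : ∀ x, φ x ≤ C) :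
    Integrable (fun ω => D.estimator φ (D.Qiter ω).toNat ω) μ ∧
      ∫ ω, D.estimator φ (D.Qiter ω).toNat ω ∂μ = ∫ x, φ x ∂π := by
  have hbm : BoundedMeasurable fun x => ENNReal.ofReal (φ x) :=
    ⟨hφ.ennreal_ofReal, C.toNNReal, fun x => ENNReal.ofReal_le_ofReal (hφC x)⟩
  have hint := hD.lintegral_final_lestimator hright hcons hfin hcase hbm
  have hm := hD.aemeasurable_final_lestimator hfin hbm.1
  have hne := hbm.lintegral_ne_top π
  rw [← hint] at hne
  have hae : (fun ω => D.estimator φ (D.Qiter ω).toNat ω) =ᵐ[μ] fun ω =>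
      (D.lestimator (fun x => ENNReal.ofReal (φ x)) (D.Qiter ω).toNat ω).toReal := by
    filter_upwards [ae_all_iff.2 hD.G_nonneg] with ω hω
    exact D.estimator_eq_toReal hφ0 (hω _)
  refine ⟨(integrable_toReal_of_lintegral_ne_top hm hne).congr hae.symm, ?_⟩
  rw [integral_congr_ae hae, integral_toReal hm (ae_lt_top' hm hne), hint,
    integral_eq_lintegral_of_nonneg_ae (ae_of_all _ hφ0) hφ.aestronglyMeasurable]

end Unbiased

end IsGAMS

theorem theorem4p1 {Ω E : Type*} [mΩ : MeasurableSpace Ω]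
    [TopologicalSpace E] [PolishSpace E] [mE : MeasurableSpace E] [BorelSpace E]
    (μ : Measure Ω) [IsProbabilityMeasure μ] (π : Measure E) [IsProbabilityMeasure π]
    (filt : Filtration ℝ mE) (κ : Kernel (ℝ × E) E) [IsMarkovKernel κ]
    (hright : RightContinuousKernel π κ) (hcons : ConsistentKernel filt π κ)
    (D : SplittingData Ω E) (hD : IsGAMS μ π filt κ D)
    (hfin : ∀ᵐ ω ∂μ, D.Qiter ω < ⊤)
    (hcase : (∃ C : ℕ, ∀ᵐ ω ∂μ, D.Qiter ω ≤ C) ∨ D.MassConserved μ)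
    (φ : E → ℝ) (hφ : Measurable φ) (hφb : ∃ C : ℝ, ∀ x, |φ x| ≤ C) :
    Integrable (fun ω => D.estimator φ (D.Qiter ω).toNat ω) μ ∧
      ∫ ω, D.estimator φ (D.Qiter ω).toNat ω ∂μ = ∫ x, φ x ∂π := by
  obtain ⟨C, hC⟩ := hφb
  have hC0 : 0 ≤ C := by
    obtain ⟨e⟩ := nonempty_of_isProbabilityMeasure π
    exact (abs_nonneg _).trans (hC e)
  -- The estimator is linear in the test function, so the nonnegative functions `φ + C` and `C`
  -- suffice. The constant needs its own estimator, whose value need not be `C` when the total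
  -- weight is random.
  obtain ⟨hi, he⟩ := hD.integral_estimator_of_nonneg hright hcons hfin hcase
    (φ := fun x => φ x + C) (hφ.add_const C) (fun x => by linarith [(abs_le.1 (hC x)).1])
    (C := C + C) fun x => by linarith [(abs_le.1 (hC x)).2]
  obtain ⟨hi', he'⟩ := hD.integral_estimator_of_nonneg hright hcons hfin hcase
    (φ := fun _ => C) measurable_const (fun _ => hC0) (C := C) fun _ => le_rfl
  have hsub : ∀ ω, D.estimator φ (D.Qiter ω).toNat ω =
      D.estimator (fun x => φ x + C) (D.Qiter ω).toNat ω -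
        D.estimator (fun _ => C) (D.Qiter ω).toNat ω := fun ω => by
    simp only [SplittingData.estimator, ← Finset.sum_sub_distrib]
    exact Finset.sum_congr rfl fun n _ => by ring
  have hφi : Integrable φ π := Integrable.of_bound hφ.aestronglyMeasurable C (ae_of_all _ hC)
  simp only [hsub]
  refine ⟨hi.sub hi', ?_⟩
  rw [integral_sub hi hi', he, he', integral_add hφi (integrable_const C)]
  ring
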